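/- Let $N,m\ge 0$ be integers and consider the $m$-component Manakov model $\mathrm i\,q_t+q_{xx}+2\|q\|^2q=0$ for $q(x,t)\in\mathbb C^m$. For row vectors write $u\cdot v^\dagger=\sum_a u_a\overline{v_a}$. Let $\zeta_j=\xi_j+\mathrm i\eta_j$ with $\eta_j>0$ $(1\le j\le N)$ and $\xi_1>\xi_2>\dots>\xi_N$ (so soliton $j$ has velocity $-4\xi_j$ and a larger number means a faster soliton), let $\alpha_j\in\mathbb R$, and let $u_j\in\mathbb C^m$ be unit vectors. Put $\tau_j=2\eta_j(x+4\xi_jt)$, $\Theta_j=2\xi_jx+4(\xi_j^2-\eta_j^2)t$, $$U_{jk}=\frac{e^{\tau_j+\alpha_j}}{2\eta_j}\delta_{jk}-\sum_{l=1}^N\frac{2\eta_l\,(u_j\cdot u_l^\dagger)}{(\zeta_l-\zeta_k^*)(\zeta_l-\zeta_j^*)}\,e^{-(\tau_l+\alpha_l)+\mathrm i(\Theta_l-\Theta_j)},\qquad q(x,t)=2\sum_{j,k=1}^N(U^{-1})_{jk}\,e^{-\mathrm i\Theta_k}u_k .$$ Then $U(x,t)$ is invertible for all real $x,t$, and $q$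 is a classical ($C^2$) solution of the Manakov model, the $N$-soliton solution. Let $d_{jk}=\frac{\mathrm i}{\zeta_k-\zeta_j^*}(u_j\cdot u_k^\dagger)$. For a set $I=\{i_1,\dots,i_p\}\subset\{1,\dots,N\}$ of $p$ elements and $n\notin I$ let $d_I=\det(d_{jk})_{j,k\in I}$ and $d_{I\cup n}=\det(d_{jk})_{j,k\in I\cup\{n\}}$, define $\phi_{I,n}\in\mathbb R$ by $$e^{-2\phi_{I,n}}=\prod_{l\in I}\left|\frac{\zeta_l-\zeta_n}{\zeta_l-\zeta_n^*}\right|^2\cdot\frac{d_{I\cup n}}{d_{nn}\,d_I},$$ and let $$u_{I,n}=e^{\phi_{I,n}}\prod_{l\in I}\frac{\zeta_l^*-\zeta_n^*}{\zeta_l-\zeta_n^*}\cdot\frac1{d_I}\begin{vmatrix}d_{i_1i_1}&\cdots&d_{i_1i_p}&u_{i_1}\\ \vdots&&\vdots&\vdots\\ d_{i_pi_1}&\cdots&d_{i_pi_p}&u_{i_p}\\ d_{ni_1}&\cdots&d_{ni_p}&u_n\end{vmatrix},$$ the determinant with a last column of vectors being expanded along that column. A soliton state is a pair (phase, polarization vector);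 soliton $n$ is in the state $s_{I,n}$ if its phase is $\alpha_n+\phi_{I,n}$ and its polarization is $u_{I,n}$. All vectors $u_{\{1,\dots,n-1\},n}$ and $u_{\{n+1,\dots,N\},n}$ are unit vectors, and uniformly in $x\in\mathbb R$ $$q-\sum_{n=1}^N2\eta_n\operatorname{sech}\bigl(\tau_n+\alpha_n+\phi_{I_n,n}\bigr)e^{-\mathrm i\Theta_n}u_{I_n,n}\longrightarrow0,$$ as $t\to-\infty$ with $I_n=\{1,\dots,n-1\}$, and as $t\to+\infty$ with $I_n=\{n+1,\dots,N\}$. Thus before the collision the solitons are arranged from left to right as $N,\dots,1$ with states $s_{\{1,\dots,n-1\},n}$ (initial configuration), and after it as $1,\dots,N$ with states $s_{\{n+1,\dots,N\},n}$ (final configuration). Two-soliton collision law: when soliton $k$ overtakes its right-hand neighbour $j<k$, the states before are related to the states after as follows. For some $\beta_j,\beta_k\in\mathbb R$ and unit vectors $v_j,v_k$, before the collision $j$ is in the state $(\beta_j,v_j)$ and $k$ in the state $(\beta_k+\varphi,w_k)$; after it $j$ is in the state $(\beta_j+\varphi,w_j)$ and $k$ in the state $(\beta_k,v_k)$, where $\varphi\in\mathbb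 R$, $$e^{-2\varphi}=\left|\frac{\zeta_j-\zeta_k}{\zeta_j-\zeta_k^*}\right|^2\Bigl\{1+\frac{(\zeta_j-\zeta_j^*)(\zeta_k-\zeta_k^*)}{|\zeta_j-\zeta_k^*|^2}|v_j\cdot v_k^\dagger|^2\Bigr\},$$ $$w_k=e^{\varphi}\frac{\zeta_j^*-\zeta_k^*}{\zeta_j-\zeta_k^*}\Bigl\{v_k-\frac{\zeta_j-\zeta_j^*}{\zeta_j-\zeta_k^*}(v_k\cdot v_j^\dagger)v_j\Bigr\},\qquad w_j=e^{\varphi}\frac{\zeta_k^*-\zeta_j^*}{\zeta_k-\zeta_j^*}\Bigl\{v_j-\frac{\zeta_k-\zeta_k^*}{\zeta_k-\zeta_j^*}(v_j\cdot v_k^\dagger)v_k\Bigr\}.$$ Call an order of pair collisions any finite sequence of overtakings, each of a slower soliton by its faster left-hand neighbour at that moment, that starts from the arrangement $N,\dots,1$ and is complete (no further overtaking is possible at its end). Such orders exist. In each of them every pair of solitons collides exactly once, so that there are $\binom N2$ collisions. For every such order, carrying out the collisions successively by the two-soliton collision law, starting from the initial configuration, is possible and leads to exactly one configuration, namely the final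 configuration, i.e. the $t\to+\infty$ asymptotic state of the $N$-soliton solution. -/

import Mathlib

open scoped ComplexConjugate

noncomputable section

namespace Manakov

/-- The Hermitian product `u · v† = ∑ₐ uₐ v̄ₐ`, linear in the first argument. -/
def hdot {m : ℕ} (u v : EuclideanSpace ℂ (Fin m)) : ℂ := inner ℂ v u

/-- `q` is a classical solution of the `m`-component Manakov model
`i q_t + q_xx + 2 ‖q‖² q = 0`; the arguments of `q` are `x` and `t`, in this order. -/
def IsSolution {m : ℕ} (q : ℝ → ℝ → EuclideanSpace ℂ (Fin m)) : Prop :=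
  ContDiff ℝ 2 (fun p : ℝ × ℝ => q p.1 p.2) ∧
  ∀ x t : ℝ, Complex.I • deriv (fun s => q x s) t + iteratedDeriv 2 (fun y => q y t) x
    + (2 * ‖q x t‖ ^ 2) • q x t = 0

/-- Parameters of an `N`-soliton solution with `m` components. The solitons have distinct
velocities `-4 Re ζ j` and are numbered so that a larger number means a faster soliton. -/
structure SolitonData (N m : ℕ) where
  /-- the discrete eigenvalues `ζ j = ξ j + i η j` -/
  ζ : Fin N → ℂ
  /-- the bare phases -/
  α : Fin N → ℝ
  /-- the bare polarization vectors -/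
  u : Fin N → EuclideanSpace ℂ (Fin m)
  im_pos : ∀ j, 0 < (ζ j).im
  norm_u : ∀ j, ‖u j‖ = 1
  re_strictAnti : StrictAnti fun j => (ζ j).re

/-- The coordinate `τ = 2 η (x + 4 ξ t)` of the envelope. -/
def tau (ζ : ℂ) (x t : ℝ) : ℝ := 2 * ζ.im * (x + 4 * ζ.re * t)

/-- The coordinate `Θ = 2 ξ x + 4 (ξ² - η²) t` of the carrier wave. -/
def Theta (ζ : ℂ) (x t : ℝ) : ℝ := 2 * ζ.re * x + 4 * (ζ.re ^ 2 - ζ.im ^ 2) * t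

/-- The state of a single soliton: its phase `β` (the envelope is centred at `τ = -β`) and its
polarization vector. -/
@[ext]
structure SolitonState (m : ℕ) where
  phase : ℝ
  pol : EuclideanSpace ℂ (Fin m)

/-- The one-soliton wave `2 η sech (τ + β) e^{-iΘ} v`. -/
def wave {m : ℕ} (ζ : ℂ) (s : SolitonState m) (x t : ℝ) : EuclideanSpace ℂ (Fin m) :=
  (((2 * ζ.im * (Real.cosh (tau ζ x t + s.phase))⁻¹ : ℝ) : ℂ)
    * Complex.exp (-Complex.I * Theta ζ x t)) • s.pol

section PairCollision

variable {m : ℕ}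

/-- The phase shift `φ₁₂` of a pair collision, given by
`e^{-2φ₁₂} = |(ζ₁ - ζ₂)/(ζ₁ - ζ₂*)|² (1 + (ζ₁ - ζ₁*)(ζ₂ - ζ₂*) |u₁ · u₂†|² / |ζ₁ - ζ₂*|²)`;
here `(ζ₁ - ζ₁*)(ζ₂ - ζ₂*) = -4 η₁ η₂`. -/
def pairShift (ζ₁ ζ₂ : ℂ) (u₁ u₂ : EuclideanSpace ℂ (Fin m)) : ℝ :=
  -(1 / 2) * Real.log (‖(ζ₁ - ζ₂) / (ζ₁ - conj ζ₂)‖ ^ 2 *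
    (1 - 4 * ζ₁.im * ζ₂.im / ‖ζ₁ - conj ζ₂‖ ^ 2 * ‖hdot u₁ u₂‖ ^ 2))

/-- The polarization vector `u_{{1},2}`. -/
def pairPol (ζ₁ ζ₂ : ℂ) (u₁ u₂ : EuclideanSpace ℂ (Fin m)) : EuclideanSpace ℂ (Fin m) :=
  ((Real.exp (pairShift ζ₁ ζ₂ u₁ u₂) : ℂ) * ((conj ζ₁ - conj ζ₂) / (ζ₁ - conj ζ₂))) •
    (u₂ - ((ζ₁ - conj ζ₁) / (ζ₁ - conj ζ₂) * hdot u₂ u₁) • u₁)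

/-- The two-soliton collision law: soliton 2 (eigenvalue `ζ₂`, initially on the left) overtakes
soliton 1 (eigenvalue `ζ₁`, initially on the right), and the states `in₁, in₂` before the
collision become `out₁, out₂` after it. -/
def PairCollision (ζ₁ ζ₂ : ℂ) (in₁ in₂ out₁ out₂ : SolitonState m) : Prop :=
  ∃ (α₁ α₂ : ℝ) (u₁ u₂ : EuclideanSpace ℂ (Fin m)), ‖u₁‖ = 1 ∧ ‖u₂‖ = 1 ∧
    in₁ = ⟨α₁, u₁⟩ ∧
    in₂ = ⟨α₂ + pairShift ζ₁ ζ₂ u₁ u₂, pairPol ζ₁ ζ₂ u₁ u₂⟩ ∧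
    out₁ = ⟨α₁ + pairShift ζ₁ ζ₂ u₁ u₂, pairPol ζ₂ ζ₁ u₂ u₁⟩ ∧
    out₂ = ⟨α₂, u₂⟩

end PairCollision

/-- `Rearranges L w w'`: starting from solitons arranged from left to right as in `w`, the list
`L` of collisions leads to the arrangement `w'`. An entry `(k, j)` of `L` is a collision in which
soliton `k` overtakes the slower soliton `j`, its right-hand neighbour at that moment. -/
inductive Rearranges {N : ℕ} :
    List (Fin N × Fin N) → List (Fin N) → List (Fin N) → Prop
  | nil (w : List (Fin N)) : Rearranges [] w w
  | cons {L : List (Fin N × Fin N)} {w : List (Fin N)} (A B : List (Fin N)) (k j : Fin N)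
      (hjk : j < k) (h : Rearranges L (A ++ j :: k :: B) w) :
      Rearranges ((k, j) :: L) (A ++ k :: j :: B) w

/-- An order of pair collisions: a sequence of collisions of neighbouring solitons which starts
from the arrangement `N, …, 2, 1` (left to right) and is complete, that is, ends in an arrangement
in which no soliton has a slower right-hand neighbour. -/
def IsCollisionOrder {N : ℕ} (L : List (Fin N × Fin N)) : Prop :=
  ∃ w : List (Fin N), Rearranges L (List.finRange N).reverse w ∧
    ¬ ∃ (A B : List (Fin N)) (k j : Fin N), j < k ∧ w = A ++ k :: j :: B

/-- A configuration of `N` solitons: their arrangement from left to right, and the state of each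
of them. -/
@[ext]
structure Config (N m : ℕ) where
  order : List (Fin N)
  state : Fin N → SolitonState m

namespace SolitonData

variable {N m : ℕ} (P : SolitonData N m)

/-- `λ_{jkl} = - 2 η_l (u_j · u_l†) / ((ζ_l - ζ_k*) (ζ_l - ζ_j*))`. -/
def lam (j k l : Fin N) : ℂ :=
  -(2 * ((P.ζ l).im : ℂ) * hdot (P.u j) (P.u l)) /
    ((P.ζ l - conj (P.ζ k)) * (P.ζ l - conj (P.ζ j)))

/-- The matrix `U` of the `N`-soliton solution. -/
def U (x t : ℝ) : Matrix (Fin N) (Fin N) ℂ := Matrix.of fun j k =>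
  (if j = k then Complex.exp ((tau (P.ζ j) x t + P.α j : ℝ) : ℂ) / (2 * ((P.ζ j).im : ℂ)) else 0)
  + ∑ l, P.lam j k l * Complex.exp (-((tau (P.ζ l) x t + P.α l : ℝ) : ℂ)
      + Complex.I * ((Theta (P.ζ l) x t - Theta (P.ζ j) x t : ℝ) : ℂ))

/-- The `N`-soliton solution `q = 2 ∑_j ∑_k (U⁻¹)_{jk} e^{-iΘ_k} u_k`. -/
def q (x t : ℝ) : EuclideanSpace ℂ (Fin m) :=
  (2 : ℂ) • ∑ j, ∑ k,
    ((P.U x t)⁻¹ j k * Complex.exp (-Complex.I * Theta (P.ζ k) x t)) • P.u k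

/-- The states `s n` of the `N` solitons form the asymptotic state of `q` along `l` (`t → -∞` or
`t → +∞`): the polarizations are unit vectors and `q` is asymptotic to the sum of the
corresponding one-soliton waves, uniformly in `x`. -/
def IsAsymptoticState (l : Filter ℝ) (s : Fin N → SolitonState m) : Prop :=
  (∀ n, ‖(s n).pol‖ = 1) ∧
  TendstoUniformly (fun t x => P.q x t - ∑ n, wave (P.ζ n) (s n) x t) 0 l

/-- `d_{jk} = i (u_j · u_k†) / (ζ_k - ζ_j*)`. -/
def d (j k : Fin N) : ℂ := Complex.I / (P.ζ k - conj (P.ζ j)) * hdot (P.u j) (P.u k)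

/-- The determinant of `d` with rows and columns in `I`. -/
def detD (I : Finset (Fin N)) : ℂ := (Matrix.of fun r c : I => P.d r c).det

/-- The determinant of `d` with rows and columns in `I` and one more row and column `n`. -/
def detD' (I : Finset (Fin N)) (n : Fin N) : ℂ :=
  (Matrix.of fun r c : Option I => P.d (r.elim n (↑)) (c.elim n (↑))).det

/-- The extended determinant with rows in `I` and `n`, columns `d_{· l}` for `l` in `I`, and a
last column consisting of the vectors `u`; it is computed component by component. -/
def vecDet (I : Finset (Fin N)) (n : Fin N) : EuclideanSpace ℂ (Fin m) :=
  WithLp.toLp 2 fun a => (Matrix.of fun r c : Option I =>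
    c.elim (P.u (r.elim n (↑)) a) (fun l => P.d (r.elim n (↑)) l)).det

/-- `φ_{I,n}`, given by
`e^{-2φ_{I,n}} = ∏_{l ∈ I} |(ζ_l - ζ_n)/(ζ_l - ζ_n*)|² · det d_{I ∪ n} / (d_{nn} det d_I)`
(a positive real number). -/
def phi (I : Finset (Fin N)) (n : Fin N) : ℝ :=
  -(1 / 2) * Real.log ((∏ l ∈ I, ‖(P.ζ l - P.ζ n) / (P.ζ l - conj (P.ζ n))‖ ^ 2) *
    (P.detD' I n / (P.d n n * P.detD I)).re)

/-- The polarization vector `u_{I,n}`. -/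
def pol (I : Finset (Fin N)) (n : Fin N) : EuclideanSpace ℂ (Fin m) :=
  ((Real.exp (P.phi I n) : ℂ) * (∏ l ∈ I, (conj (P.ζ l) - conj (P.ζ n)) / (P.ζ l - conj (P.ζ n)))
    / P.detD I) • P.vecDet I n

/-- The state `q_{I,n}` of soliton `n`. -/
def solitonState (I : Finset (Fin N)) (n : Fin N) : SolitonState m :=
  ⟨P.α n + P.phi I n, P.pol I n⟩

/-- The asymptotic configuration as `t → -∞`: the solitons are arranged as `N, …, 1`, and
soliton `n` is in the state `q_{{1,…,n-1},n}`. -/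
def initialConfig : Config N m where
  order := (List.finRange N).reverse
  state n := P.solitonState (Finset.Iio n) n

/-- The asymptotic configuration as `t → +∞`: the solitons are arranged as `1, …, N`, and
soliton `n` is in the state `q_{{n+1,…,N},n}`. -/
def finalConfig : Config N m where
  order := List.finRange N
  state n := P.solitonState (Finset.Ioi n) n

/-- `Evolves L c c'`: the pair collisions listed in `L`, each between the current states of
neighbouring solitons and following the two-soliton collision law, transform the configuration `c`
into `c'`. -/
inductive Evolves : List (Fin N × Fin N) → Config N m → Config N m → Prop
  | nil (c : Config N m) : Evolves [] c c
  | cons {L : List (Fin N × Fin N)} {c : Config N m} (A B : List (Fin N)) (k j : Fin N)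
      (s s' : Fin N → SolitonState m) (hjk : j < k)
      (hcoll : PairCollision (P.ζ j) (P.ζ k) (s j) (s k) (s' j) (s' k))
      (hrest : ∀ i, i ≠ j → i ≠ k → s' i = s i)
      (h : Evolves L ⟨A ++ j :: k :: B, s'⟩ c) :
      Evolves ((k, j) :: L) ⟨A ++ k :: j :: B, s⟩ c

end SolitonData

end Manakov

end

/-! Everything rests on the displacement equation `d_mul`: `d_{jk} (ζ_k - ζ_j*)` is `i` times the
Gram matrix of the `u_j`. Gaussian elimination preserves this form. If `c` holds the coefficients
that clear the columns in `I` from row `n` (`IsReduced`), then the Schur complement satisfies the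
same equation, with `u_n` replaced by `P.comb c = ∑ c_l u_l` (`IsReduced.mulD_mul`). The bordered
determinants of the statement are `detD I` times `mulD c n` and `P.comb c`, so up to normalization
and a scalar factor `u_{I,n}` is `P.comb c`. Eliminating one more column `j` is a single step
between the vectors of `j` and `k` at level `I`, and after normalization it is the two-soliton law
(`solitonState_insert`).

Hence one collision of `k` with `j`, the solitons in `I` lying to the right of both, turns the
states belonging to `I` and `I ∪ j` into those belonging to `I ∪ k` and `I`
(`pairCollision_solitonState`). The invariant is that every soliton is in the state indexed by the
set of solitons to its right. Exchanging neighbours changes this set only for the colliding pair.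
Since the state depends only on the set, the order of collisions is irrelevant. The law is injective
in the incoming data (`PairCollision.unique`), so the outcome is unique (`evolves_iff`).

For the asymptotics, `σ = e^{τ+α}/(2η)` is replaced by `σ/(1+σ)`, which lies in `[0,1]`, and the
carriers are treated as independent unimodular variables. With an auxiliary unknown the linear
system for `q` extends to the boundary and stays invertible, because `d` and the Cauchy matrix are
positive definite (`posOn`, `sysMat_det_ne_zero`). Thus `q` is a uniformly continuous function on a
compact set. Near any `x` at large `|t|`, all envelopes except that of the nearest soliton are close
to `0` or `1`, and there the solution is exactly one wave (`sysSol_eq_wave`).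

The differential equation follows from noncommutative algebra. The matrix `S`, which is `U` without
its row carriers, is built from diagonal exponentials and two matrices with displacement equations.
These relations alone give an identity for the derivatives of `S⁻¹` (`IsDressing.equation`), and a
linear read-out turns it into the Manakov model. -/

open scoped ComplexConjugate

noncomputable section

namespace Manakov

/-! ### The Hermitian product and bordered determinants. -/

section Hdot

variable {m : ℕ}

theorem hdot_eq_sum (u v : EuclideanSpace ℂ (Fin m)) : hdot u v = ∑ a, u a * conj (v a) := by
  simp [hdot, PiLp.inner_apply]

theorem conj_hdot (u v : EuclideanSpace ℂ (Fin m)) : conj (hdot u v) = hdot v u :=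
  inner_conj_symm _ _

theorem hdot_sub_left (u v w : EuclideanSpace ℂ (Fin m)) :
    hdot (u - v) w = hdot u w - hdot v w := inner_sub_right _ _ _

theorem hdot_sub_right (u v w : EuclideanSpace ℂ (Fin m)) :
    hdot u (v - w) = hdot u v - hdot u w := inner_sub_left _ _ _

theorem hdot_smul_left (c : ℂ) (u v : EuclideanSpace ℂ (Fin m)) :
    hdot (c • u) v = c * hdot u v := inner_smul_right _ _ _

theorem hdot_smul_right (c : ℂ) (u v : EuclideanSpace ℂ (Fin m)) :
    hdot u (c • v) = conj c * hdot u v := inner_smul_left _ _ _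

theorem hdot_sum_left {ι : Type*} (s : Finset ι) (f : ι → EuclideanSpace ℂ (Fin m))
    (v : EuclideanSpace ℂ (Fin m)) : hdot (∑ i ∈ s, f i) v = ∑ i ∈ s, hdot (f i) v :=
  inner_sum s f v

theorem hdot_sum_right {ι : Type*} (s : Finset ι) (f : ι → EuclideanSpace ℂ (Fin m))
    (v : EuclideanSpace ℂ (Fin m)) : hdot v (∑ i ∈ s, f i) = ∑ i ∈ s, hdot v (f i) :=
  sum_inner s f v

theorem hdot_self (u : EuclideanSpace ℂ (Fin m)) : hdot u u = (‖u‖ : ℂ) ^ 2 :=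
  inner_self_eq_norm_sq_to_K u

end Hdot

theorem sub_conj_ne_zero {z w : ℂ} (hz : 0 < z.im) (hw : 0 < w.im) : z - conj w ≠ 0 := by
  intro h
  have := congrArg Complex.im h
  simp at this
  linarith

theorem sub_conj_self (z : ℂ) : z - conj z = 2 * Complex.I * z.im := by
  rw [Complex.sub_conj]; push_cast; ring

/-- A bordered determinant with an invertible principal block is computed by eliminating the
border row by a linear combination of the other rows. -/
theorem det_option_eq {ι : Type*} [Fintype ι] [DecidableEq ι]
    (M : Matrix (Option ι) (Option ι) ℂ) (a : ι → ℂ)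
    (ha : ∀ k, M none (some k) + ∑ l, a l * M (some l) (some k) = 0) :
    M.det = (Matrix.of fun r c : ι => M (some r) (some c)).det *
      (M none none + ∑ l, a l * M (some l) none) := by
  set N := M.updateRow none (M none + ∑ l, a l • M (some l)) with hN
  have h1 : N.det = M.det := by
    have := Matrix.det_updateRow_sum M none (fun r => r.elim 1 a)
    simp only [Fintype.sum_option, Option.elim, one_smul] at this
    rw [hN, this]
  have e : N.reindex (Equiv.optionEquivSumPUnit.{0} ι) (Equiv.optionEquivSumPUnit.{0} ι) =
      Matrix.fromBlocks (Matrix.of fun r c : ι => M (some r) (some c))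
        (Matrix.of fun r _ => M (some r) none) 0
        (Matrix.of fun _ _ => M none none + ∑ l, a l * M (some l) none) := by
    ext i j
    rcases i with i | i <;> rcases j with j | j
    · simp [hN, Matrix.updateRow_apply]
    · simp [hN, Matrix.updateRow_apply]
    · simpa [hN, Matrix.updateRow_apply] using ha j
    · simp [hN, Matrix.updateRow_apply]
  rw [← h1, ← Matrix.det_reindex_self (Equiv.optionEquivSumPUnit.{0} ι) N, e,
    Matrix.det_fromBlocks_zero₂₁]
  simp

/-! ### Elimination in the matrix `d` and its positivity. -/

namespace SolitonData

variable {N m : ℕ} (P : SolitonData N m)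

theorem ζ_sub_conj_ne (j k : Fin N) : P.ζ j - conj (P.ζ k) ≠ 0 :=
  sub_conj_ne_zero (P.im_pos j) (P.im_pos k)

theorem ζ_injective : Function.Injective P.ζ := fun _ _ h =>
  P.re_strictAnti.injective (congrArg Complex.re h)

theorem d_mul (j k : Fin N) :
    P.d j k * (P.ζ k - conj (P.ζ j)) = Complex.I * hdot (P.u j) (P.u k) := by
  have := P.ζ_sub_conj_ne k j
  rw [d]; field_simp

theorem conj_d (j k : Fin N) : conj (P.d j k) = P.d k j := by
  simp only [d, map_mul, map_div₀, Complex.conj_I, map_sub, Complex.conj_conj, conj_hdot]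
  rw [← neg_sub (P.ζ j), div_neg, neg_div, neg_neg]

theorem d_self (n : Fin N) : P.d n n = (((2 * (P.ζ n).im)⁻¹ : ℝ) : ℂ) := by
  have := (P.im_pos n).ne'
  rw [d, sub_conj_self, hdot_self, P.norm_u]
  have h : ((P.ζ n).im : ℂ) ≠ 0 := by exact_mod_cast this
  push_cast
  field_simp

/-- The row vector `x d`. -/
def mulD (x : Fin N → ℂ) (k : Fin N) : ℂ := ∑ j, x j * P.d j k

/-- The sesquilinear form of the matrix `d`. -/
def formD (x y : Fin N → ℂ) : ℂ := ∑ k, P.mulD x k * conj (y k)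

/-- The combination `∑ x_l u_l` of the bare polarization vectors. -/
def comb (x : Fin N → ℂ) : EuclideanSpace ℂ (Fin m) := ∑ l, x l • P.u l

theorem mulD_add (x y : Fin N → ℂ) (k : Fin N) :
    P.mulD (x + y) k = P.mulD x k + P.mulD y k := by
  simp [mulD, add_mul, Finset.sum_add_distrib]

theorem mulD_smul (c : ℂ) (x : Fin N → ℂ) (k : Fin N) :
    P.mulD (c • x) k = c * P.mulD x k := by
  simp [mulD, Finset.mul_sum, mul_assoc]

theorem mulD_sub (x y : Fin N → ℂ) (k : Fin N) :
    P.mulD (x - y) k = P.mulD x k - P.mulD y k := by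
  simp [mulD, sub_mul, Finset.sum_sub_distrib]

theorem comb_sub (x y : Fin N → ℂ) : P.comb (x - y) = P.comb x - P.comb y := by
  simp [comb, sub_smul, Finset.sum_sub_distrib]

theorem comb_smul (c : ℂ) (x : Fin N → ℂ) : P.comb (c • x) = c • P.comb x := by
  simp [comb, Finset.smul_sum, smul_smul]

/-- The displacement equation of the matrix `d`. -/
theorem mulD_mul_ζ (x : Fin N → ℂ) (k : Fin N) :
    P.mulD x k * P.ζ k - P.mulD (fun j => x j * conj (P.ζ j)) k =
      Complex.I * hdot (P.comb x) (P.u k) := by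
  simp only [mulD, comb, hdot_sum_left, hdot_smul_left, Finset.sum_mul, Finset.mul_sum,
    ← Finset.sum_sub_distrib]
  refine Finset.sum_congr rfl fun j _ => ?_
  linear_combination x j * P.d_mul j k

theorem conj_formD (x y : Fin N → ℂ) : conj (P.formD x y) = P.formD y x := by
  simp only [formD, mulD, map_sum, map_mul, Complex.conj_conj, conj_d, Finset.sum_mul]
  rw [Finset.sum_comm]
  refine Finset.sum_congr rfl fun j _ => Finset.sum_congr rfl fun k _ => by ring

theorem formD_eq_sum_conj (x y : Fin N → ℂ) :
    P.formD x y = ∑ j, x j * conj (P.mulD y j) := by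
  rw [← conj_formD, formD, map_sum]
  simp [mul_comm]

/-- `c` is the coefficient vector of the row `n` of the matrix `d` after elimination of the
columns in `I` with the help of the rows in `I`. -/
structure IsReduced (I : Finset (Fin N)) (n : Fin N) (c : Fin N → ℂ) : Prop where
  not_mem : n ∉ I
  apply_self : c n = 1
  apply_of_not_mem : ∀ l, l ≠ n → l ∉ I → c l = 0
  mulD_eq_zero : ∀ k ∈ I, P.mulD c k = 0

namespace IsReduced

variable {P} {I : Finset (Fin N)} {j k : Fin N} {c e : Fin N → ℂ}

/-- The row `c d` vanishes on `I`, while `e` vanishes outside `I ∪ {k}`, so only the index `k`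
survives. -/
theorem sum_mulD (hc : P.IsReduced I j c) (he : P.IsReduced I k e) (f : Fin N → ℂ) :
    ∑ l, P.mulD c l * conj (e l) * f l = P.mulD c k * f k := by
  rw [Finset.sum_eq_single k]
  · simp [he.apply_self]
  · intro l _ hl
    by_cases h : l ∈ I
    · simp [hc.mulD_eq_zero l h]
    · simp [he.apply_of_not_mem l hl h]
  · simp

theorem formD_eq (hc : P.IsReduced I j c) (he : P.IsReduced I k e) :
    P.formD c e = P.mulD c k := by
  simpa [formD] using hc.sum_mulD he 1

/-- Elimination preserves displacement structure: the Schur complement `mulD c k` relates to the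
eliminated vectors exactly as `d j k` does to `u_j` and `u_k`. Pair the displacement equation of `c`
with `e`; both terms on its left collapse by `sum_mulD`. -/
theorem mulD_mul (hc : P.IsReduced I j c) (he : P.IsReduced I k e) :
    P.mulD c k * (P.ζ k - conj (P.ζ j)) = Complex.I * hdot (P.comb c) (P.comb e) := by
  have h1 := hc.sum_mulD he P.ζ
  -- The weights `ζ_j*` sit on the side of `c`; Hermitian symmetry moves `d` onto `e`, where the
  -- collapse applies with the roles of `c` and `e` exchanged.
  have h2 : ∑ l, P.mulD (fun j => c j * conj (P.ζ j)) l * conj (e l)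
      = P.mulD c k * conj (P.ζ j) := by
    have : ∑ l, P.mulD (fun j => c j * conj (P.ζ j)) l * conj (e l) =
        P.formD (fun j => c j * conj (P.ζ j)) e := rfl
    rw [this, formD_eq_sum_conj]
    have h3 := congrArg conj (he.sum_mulD hc P.ζ)
    rw [map_sum, map_mul, ← he.formD_eq hc, conj_formD, hc.formD_eq he] at h3
    rw [← h3]
    refine Finset.sum_congr rfl fun l _ => ?_
    simp only [map_mul, Complex.conj_conj]; ring
  have h4 : ∑ l, conj (e l) * (P.mulD c l * P.ζ l - P.mulD (fun j => c j * conj (P.ζ j)) l) =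
      Complex.I * hdot (P.comb c) (P.comb e) := by
    simp only [mulD_mul_ζ]
    conv_rhs => rw [comb, comb, hdot_sum_right, Finset.mul_sum]
    refine Finset.sum_congr rfl fun l _ => ?_
    rw [hdot_smul_right, comb]; ring
  rw [← h4, mul_sub, ← h1, ← h2, ← Finset.sum_sub_distrib]
  exact Finset.sum_congr rfl fun l _ => by ring

/-- The pivot of the elimination. This diagonal case is the source of positivity and of the phase
`φ_{I,n}`. -/
theorem mulD_self (hc : P.IsReduced I j c) :
    P.mulD c j = ((‖P.comb c‖ ^ 2 / (2 * (P.ζ j).im) : ℝ) : ℂ) := by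
  have h := hc.mulD_mul hc
  have h0 : ((P.ζ j).im : ℂ) ≠ 0 := by exact_mod_cast (P.im_pos j).ne'
  rw [sub_conj_self, hdot_self] at h
  push_cast
  rw [eq_div_iff (by simpa using h0)]
  apply mul_left_cancel₀ Complex.I_ne_zero
  linear_combination h

end IsReduced

/-- Positivity of the form of `d` on the vectors supported in `I`. -/
def PosOn (I : Finset (Fin N)) : Prop :=
  ∀ x : Fin N → ℂ, (∀ l ∉ I, x l = 0) → x ≠ 0 → 0 < (P.formD x x).re

variable {P}

theorem PosOn.eq_zero {I : Finset (Fin N)} (h : P.PosOn I) {x : Fin N → ℂ}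
    (hx : ∀ l ∉ I, x l = 0) (h0 : ∀ k ∈ I, P.mulD x k = 0) : x = 0 := by
  by_contra hne
  have := h x hx hne
  rw [formD, Finset.sum_eq_zero] at this
  · simp at this
  · intro k _
    by_cases hk : k ∈ I
    · simp [h0 k hk]
    · simp [hx k hk]

theorem mulD_extend {I : Finset (Fin N)} (a : I → ℂ) (k : Fin N) :
    P.mulD (fun l => if h : l ∈ I then a ⟨l, h⟩ else 0) k = ∑ l : I, a l * P.d l k := by
  rw [mulD, ← Finset.sum_subset (Finset.subset_univ I), ← Finset.sum_coe_sort]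
  · exact Finset.sum_congr rfl fun l _ => by simp
  · intro l _ hl; simp [hl]

theorem PosOn.detD_ne_zero {I : Finset (Fin N)} (h : P.PosOn I) : P.detD I ≠ 0 := by
  intro h0
  obtain ⟨a, ha, hD⟩ := Matrix.exists_vecMul_eq_zero_iff.mpr h0
  apply ha
  have := h.eq_zero (x := fun l => if h : l ∈ I then a ⟨l, h⟩ else 0) (fun l hl => by simp [hl])
    (fun k hk => by
      rw [mulD_extend]
      simpa [Matrix.vecMul, dotProduct] using congrFun hD ⟨k, hk⟩)
  ext l
  simpa using congrFun this l

theorem PosOn.exists_isReduced {I : Finset (Fin N)} (h : P.PosOn I) {n : Fin N} (hn : n ∉ I) :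
    ∃ c, P.IsReduced I n c := by
  set M := Matrix.of fun r c : I => P.d r c with hM
  have hdet : IsUnit M.det := isUnit_iff_ne_zero.mpr h.detD_ne_zero
  set a := Matrix.vecMul (fun k : I => -P.d n k) M⁻¹ with ha
  have haM : Matrix.vecMul a M = fun k : I => -P.d n k := by
    rw [ha, Matrix.vecMul_vecMul, Matrix.nonsing_inv_mul _ hdet, Matrix.vecMul_one]
  refine ⟨(fun l => if h : l ∈ I then a ⟨l, h⟩ else 0) + Pi.single n 1, hn, by simp [hn], ?_, ?_⟩
  · intro l hl hlI; simp [hl, hlI]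
  · intro k hk
    have h2 := congrFun haM ⟨k, hk⟩
    simp only [Matrix.vecMul, dotProduct, hM, Matrix.of_apply] at h2
    rw [mulD_add, mulD_extend, h2]
    simp [mulD, Pi.single_apply]

/-- This is where distinctness of the eigenvalues enters. If the combination vanished, the
displacement equation would show that the vector `c_l ζ_l*` is also annihilated on `I`. Definiteness
on `I` then forces `c` to be the `n`-th unit vector, whose combination is the unit vector `u_n`. -/
theorem PosOn.comb_ne_zero {I : Finset (Fin N)} (h : P.PosOn I) {n : Fin N} {c : Fin N → ℂ}
    (hc : P.IsReduced I n c) : P.comb c ≠ 0 := by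
  intro h0
  have hD : ∀ k ∈ I, P.mulD (fun j => c j * conj (P.ζ j)) k = 0 := fun k hk => by
    have := P.mulD_mul_ζ c k
    simpa [h0, hc.mulD_eq_zero k hk, hdot] using this
  -- Subtracting `ζ_n* c` removes the entry at `n`, so the vector is supported in `I`.
  have hx := h.eq_zero (x := (fun j => c j * conj (P.ζ j)) - conj (P.ζ n) • c)
    (fun l hl => by
      by_cases hln : l = n
      · subst hln; simp [mul_comm]
      · simp [hc.apply_of_not_mem l hln hl])
    (fun k hk => by rw [mulD_sub, mulD_smul, hD k hk, hc.mulD_eq_zero k hk]; simp)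
  have hc' : ∀ l, l ≠ n → c l = 0 := fun l hl => by
    have h1 := congrFun hx l
    have h2 : c l * (conj (P.ζ l) - conj (P.ζ n)) = 0 := by
      rw [← Pi.zero_apply (M := fun _ => ℂ) l, ← h1]; simp; ring
    rcases mul_eq_zero.mp h2 with h3 | h3
    · exact h3
    · rw [← map_sub, map_eq_zero, sub_eq_zero] at h3
      exact absurd (P.ζ_injective h3) hl
  rw [comb, Finset.sum_eq_single n (fun l _ hl => by simp [hc' l hl]) (by simp),
    hc.apply_self, one_smul] at h0
  simpa [h0] using P.norm_u n

variable (P)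

/-- Completing the square, one index at a time: the reduced vector is orthogonal to everything
supported in `I`, and its own form value is the pivot, positive by `mulD_self`. The induction also
supplies what is needed to construct that vector and to show that its combination is nonzero. -/
theorem posOn (I : Finset (Fin N)) : P.PosOn I := by
  induction I using Finset.induction_on with
  | empty => exact fun x hx h => absurd (funext fun l => hx l (by simp)) h
  | insert n I hn ih =>
    intro x hx hne
    obtain ⟨c, hc⟩ := ih.exists_isReduced hn
    have hpos : 0 < (P.mulD c n).re := by
      rw [hc.mulD_self, Complex.ofReal_re]
      have := norm_pos_iff.mpr (ih.comb_ne_zero hc)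
      have := P.im_pos n
      positivity
    set y := x - x n • c with hy
    have hyI : ∀ l ∉ I, y l = 0 := fun l hl => by
      by_cases hln : l = n
      · subst hln; simp [hy, hc.apply_self]
      · simp [hy, hc.apply_of_not_mem l hln hl, hx l (by simp [hl, hln])]
    have hxy : x = x n • c + y := by simp [hy]
    have hcross : P.formD c y = 0 := by
      rw [formD]
      refine Finset.sum_eq_zero fun k _ => ?_
      by_cases hk : k ∈ I
      · simp [hc.mulD_eq_zero k hk]
      · simp [hyI k hk]
    have hexp : P.formD x x = x n * conj (x n) * P.formD c c + P.formD y y := by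
      have h1 : P.formD x x = x n * conj (x n) * P.formD c c + x n * P.formD c y
          + conj (x n) * P.formD y c + P.formD y y := by
        simp only [formD, Finset.mul_sum, ← Finset.sum_add_distrib]
        refine Finset.sum_congr rfl fun k _ => ?_
        conv_lhs => rw [hxy, mulD_add, mulD_smul]
        simp only [Pi.add_apply, Pi.smul_apply, smul_eq_mul, map_add, map_mul]
        ring
      have h2 : P.formD y c = 0 := by rw [← conj_formD, hcross, map_zero]
      rw [h1, hcross, h2]; ring
    have hre : (P.formD x x).re = ‖x n‖ ^ 2 * (P.mulD c n).re + (P.formD y y).re := by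
      rw [hexp, hc.formD_eq hc, Complex.mul_conj, Complex.add_re, Complex.re_ofReal_mul,
        Complex.normSq_eq_norm_sq]
    rw [hre]
    by_cases hy0 : y = 0
    · have hxn : x n ≠ 0 := fun h => hne (by rw [hxy, h, hy0]; simp)
      have := norm_pos_iff.mpr hxn
      have h0 : (P.formD y y).re = 0 := by simp [hy0, formD]
      rw [h0]; positivity
    · have := ih y hyI hy0
      positivity

theorem detD_ne_zero (I : Finset (Fin N)) : P.detD I ≠ 0 := (P.posOn I).detD_ne_zero

variable {P}

namespace IsReduced

variable {I : Finset (Fin N)} {j k n : Fin N} {c c' e : Fin N → ℂ}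

theorem unique (hc : P.IsReduced I n c) (hc' : P.IsReduced I n c') : c = c' := by
  have := (P.posOn I).eq_zero (x := c - c') (fun l hl => by
    by_cases h : l = n
    · subst h; simp [hc.apply_self, hc'.apply_self]
    · simp [hc.apply_of_not_mem l h hl, hc'.apply_of_not_mem l h hl])
    (fun k hk => by rw [mulD_sub, hc.mulD_eq_zero k hk, hc'.mulD_eq_zero k hk, sub_zero])
  exact sub_eq_zero.mp this

theorem sum_eq (hc : P.IsReduced I n c) (f : Fin N → ℂ) :
    ∑ l, c l * f l = f n + ∑ l : I, c l * f l := by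
  rw [Finset.sum_coe_sort I (fun l => c l * f l),
    ← Finset.sum_subset (Finset.subset_univ (insert n I)), Finset.sum_insert hc.not_mem,
    hc.apply_self, one_mul]
  intro l _ hl
  simp only [Finset.mem_insert, not_or] at hl
  simp [hc.apply_of_not_mem l hl.1 hl.2]

/-- The entries of `c` are the row operations that clear the border, as `det_option_eq` requires;
the same holds for `vecDet_eq`. -/
theorem detD'_eq (hc : P.IsReduced I n c) : P.detD' I n = P.detD I * P.mulD c n := by
  rw [detD', det_option_eq _ (fun l : I => c l), mulD, hc.sum_eq]
  · rfl
  · intro k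
    have := hc.mulD_eq_zero k k.2
    rw [mulD, hc.sum_eq] at this
    exact this

theorem vecDet_eq (hc : P.IsReduced I n c) : P.vecDet I n = P.detD I • P.comb c := by
  ext a
  have h1 : P.comb c a = ∑ l, c l * P.u l a := by simp [comb]
  rw [PiLp.smul_apply, h1, hc.sum_eq, smul_eq_mul, vecDet]
  rw [PiLp.toLp_apply, det_option_eq _ (fun l : I => c l)]
  · rfl
  · intro k
    have := hc.mulD_eq_zero k k.2
    rw [mulD, hc.sum_eq] at this
    exact this

theorem comb_ne_zero (hc : P.IsReduced I n c) : P.comb c ≠ 0 := (P.posOn I).comb_ne_zero hc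

theorem norm_comb_pos (hc : P.IsReduced I n c) : 0 < ‖P.comb c‖ :=
  norm_pos_iff.mpr hc.comb_ne_zero

/-- Elimination of one more column. -/
theorem insert (hjk : j ≠ k) (hc : P.IsReduced I j c) (he : P.IsReduced I k e) :
    P.IsReduced (insert j I) k (e - ((P.ζ j - conj (P.ζ j)) / (P.ζ j - conj (P.ζ k)) *
      (hdot (P.comb e) (P.comb c) / (‖P.comb c‖ : ℂ) ^ 2)) • c) := by
  have h0 : (‖P.comb c‖ : ℂ) ^ 2 ≠ 0 := by
    exact_mod_cast pow_ne_zero 2 hc.norm_comb_pos.ne'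
  have h1 := P.ζ_sub_conj_ne j j
  have h2 := P.ζ_sub_conj_ne j k
  refine ⟨by simp [hjk.symm, he.not_mem], ?_, ?_, ?_⟩
  · simp [he.apply_self, hc.apply_of_not_mem k hjk.symm he.not_mem]
  · intro l hl hlI
    simp only [Finset.mem_insert, not_or] at hlI
    simp [hc.apply_of_not_mem l hlI.1 hlI.2, he.apply_of_not_mem l hl hlI.2]
  · intro l hl
    rw [mulD_sub, mulD_smul]
    rcases Finset.mem_insert.mp hl with rfl | hl
    -- The multiplier must be the quotient of these two entries of the Schur complement, both known
    -- from `mulD_mul`.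
    · have e1 : P.mulD e l = Complex.I * hdot (P.comb e) (P.comb c) / (P.ζ l - conj (P.ζ k)) := by
        rw [eq_div_iff h2]; exact he.mulD_mul hc
      have e2 : P.mulD c l = Complex.I * (‖P.comb c‖ : ℂ) ^ 2 / (P.ζ l - conj (P.ζ l)) := by
        rw [eq_div_iff h1, ← hdot_self]; exact hc.mulD_mul hc
      rw [e1, e2]
      generalize (‖P.comb c‖ : ℂ) ^ 2 = r at h0 ⊢
      field_simp
      ring
    · simp [hc.mulD_eq_zero l hl, he.mulD_eq_zero l hl]

end IsReduced

variable (P)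

theorem exists_isReduced {I : Finset (Fin N)} {n : Fin N} (hn : n ∉ I) : ∃ c, P.IsReduced I n c :=
  (P.posOn I).exists_isReduced hn

end SolitonData

/-! ### The two-soliton collision law. -/

section Pair

variable {m : ℕ}

/-- The complex factor `(ζ₁* - ζ₂*) / (ζ₁ - ζ₂*)` of a pair collision. -/
def pairFactor (ζ₁ ζ₂ : ℂ) : ℂ := (conj ζ₁ - conj ζ₂) / (ζ₁ - conj ζ₂)

/-- The polarization vector of soliton 2 after elimination of soliton 1, before normalization. -/
def pairVec (ζ₁ ζ₂ : ℂ) (u₁ u₂ : EuclideanSpace ℂ (Fin m)) : EuclideanSpace ℂ (Fin m) :=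
  u₂ - ((ζ₁ - conj ζ₁) / (ζ₁ - conj ζ₂) * hdot u₂ u₁) • u₁

variable {ζ₁ ζ₂ : ℂ} {u₁ u₂ : EuclideanSpace ℂ (Fin m)}

theorem norm_pairFactor (ζ₁ ζ₂ : ℂ) : ‖pairFactor ζ₁ ζ₂‖ = ‖(ζ₁ - ζ₂) / (ζ₁ - conj ζ₂)‖ := by
  rw [pairFactor, norm_div, norm_div, ← map_sub, Complex.norm_conj]

theorem pairFactor_ne_zero (h₁ : 0 < ζ₁.im) (h₂ : 0 < ζ₂.im) (h : ζ₁ ≠ ζ₂) :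
    pairFactor ζ₁ ζ₂ ≠ 0 := by
  refine div_ne_zero ?_ (sub_conj_ne_zero h₁ h₂)
  rw [← map_sub, ne_eq, map_eq_zero]
  exact sub_ne_zero.mpr h

/-- The map `u₂ ↦ pairVec` scales the component along `u₁` by `pairFactor` and fixes the orthogonal
complement; hence it is injective when the eigenvalues differ. -/
theorem hdot_pairVec (h₁ : 0 < ζ₁.im) (h₂ : 0 < ζ₂.im) (hu₁ : ‖u₁‖ = 1) :
    hdot (pairVec ζ₁ ζ₂ u₁ u₂) u₁ = pairFactor ζ₁ ζ₂ * hdot u₂ u₁ := by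
  have h0 := sub_conj_ne_zero h₁ h₂
  rw [pairVec, hdot_sub_left, hdot_smul_left, hdot_self, hu₁, pairFactor]
  push_cast
  field_simp
  ring

theorem pairVec_smul (c : ℂ) :
    pairVec ζ₁ ζ₂ u₁ (c • u₂) = c • pairVec ζ₁ ζ₂ u₁ u₂ := by
  rw [pairVec, pairVec, hdot_smul_left, smul_sub, smul_smul]
  congr 2; ring

theorem pairVec_sub (v₂ : EuclideanSpace ℂ (Fin m)) :
    pairVec ζ₁ ζ₂ u₁ (u₂ - v₂) = pairVec ζ₁ ζ₂ u₁ u₂ - pairVec ζ₁ ζ₂ u₁ v₂ := by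
  rw [pairVec, pairVec, pairVec, hdot_sub_left]
  module

theorem eq_zero_of_pairVec_eq_zero (h₁ : 0 < ζ₁.im) (h₂ : 0 < ζ₂.im) (h : ζ₁ ≠ ζ₂)
    (hu₁ : ‖u₁‖ = 1) (h0 : pairVec ζ₁ ζ₂ u₁ u₂ = 0) : u₂ = 0 := by
  have h3 := hdot_pairVec (u₂ := u₂) h₁ h₂ hu₁
  rw [h0, hdot, inner_zero_right, eq_comm, mul_eq_zero] at h3
  have h4 := h3.resolve_left (pairFactor_ne_zero h₁ h₂ h)
  simpa [pairVec, h4] using h0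

theorem norm_pairVec_sq (h₁ : 0 < ζ₁.im) (h₂ : 0 < ζ₂.im) (hu₁ : ‖u₁‖ = 1) (hu₂ : ‖u₂‖ = 1) :
    ‖pairVec ζ₁ ζ₂ u₁ u₂‖ ^ 2 =
      1 - 4 * ζ₁.im * ζ₂.im / ‖ζ₁ - conj ζ₂‖ ^ 2 * ‖hdot u₁ u₂‖ ^ 2 := by
  have h0 := sub_conj_ne_zero h₁ h₂
  have h0' : conj ζ₁ - ζ₂ ≠ 0 := by simpa using (map_ne_zero (starRingEnd ℂ)).mpr h0
  have e1 : ((‖ζ₁ - conj ζ₂‖ ^ 2 : ℝ) : ℂ) = (ζ₁ - conj ζ₂) * (conj ζ₁ - ζ₂) := by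
    rw [← Complex.normSq_eq_norm_sq, ← Complex.mul_conj]; simp
  have e2 : ((‖hdot u₁ u₂‖ ^ 2 : ℝ) : ℂ) = hdot u₁ u₂ * hdot u₂ u₁ := by
    rw [← Complex.normSq_eq_norm_sq, ← Complex.mul_conj, conj_hdot]
  have e3 : ((4 * ζ₁.im * ζ₂.im : ℝ) : ℂ) = -((ζ₁ - conj ζ₁) * (ζ₂ - conj ζ₂)) := by
    rw [sub_conj_self, sub_conj_self]; push_cast
    linear_combination (4 * (ζ₁.im : ℂ) * ζ₂.im) * Complex.I_sq
  apply Complex.ofReal_injective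
  rw [Complex.ofReal_sub, Complex.ofReal_mul, Complex.ofReal_div, e1, e2, e3,
    Complex.ofReal_pow, ← hdot_self]
  conv_lhs => rw [pairVec]
  simp only [hdot_sub_left, hdot_sub_right, hdot_smul_left, hdot_smul_right, map_mul, map_div₀,
    map_sub, Complex.conj_conj, conj_hdot]
  rw [hdot_self, hdot_self, hu₁, hu₂, Complex.ofReal_one]
  field_simp
  ring

/-- In this form the phase shift is visibly the logarithm of the constant that normalizes the new
polarization. -/
theorem pairShift_eq (h₁ : 0 < ζ₁.im) (h₂ : 0 < ζ₂.im) (hu₁ : ‖u₁‖ = 1) (hu₂ : ‖u₂‖ = 1) :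
    pairShift ζ₁ ζ₂ u₁ u₂ = -Real.log (‖pairFactor ζ₁ ζ₂‖ * ‖pairVec ζ₁ ζ₂ u₁ u₂‖) := by
  rw [pairShift, ← norm_pairFactor, ← norm_pairVec_sq h₁ h₂ hu₁ hu₂, ← mul_pow, Real.log_pow]
  push_cast; ring

theorem pairShift_comm (ζ₁ ζ₂ : ℂ) (u₁ u₂ : EuclideanSpace ℂ (Fin m)) :
    pairShift ζ₁ ζ₂ u₁ u₂ = pairShift ζ₂ ζ₁ u₂ u₁ := by
  have e1 : ‖ζ₂ - conj ζ₁‖ = ‖ζ₁ - conj ζ₂‖ := by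
    rw [← Complex.norm_conj, map_sub, Complex.conj_conj, norm_sub_rev]
  have e2 : ‖hdot u₂ u₁‖ = ‖hdot u₁ u₂‖ := by rw [← conj_hdot, Complex.norm_conj]
  rw [pairShift, pairShift, norm_div, norm_div, e1, e2, norm_sub_rev ζ₂ ζ₁]
  congr 4; ring

theorem pairPol_def : pairPol ζ₁ ζ₂ u₁ u₂ =
    ((Real.exp (pairShift ζ₁ ζ₂ u₁ u₂) : ℂ) * pairFactor ζ₁ ζ₂) • pairVec ζ₁ ζ₂ u₁ u₂ := rfl

/-- The collision law determines the states after a collision from those before it. -/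
theorem PairCollision.unique (h₁ : 0 < ζ₁.im) (h₂ : 0 < ζ₂.im) (h : ζ₁ ≠ ζ₂)
    {in₁ in₂ out₁ out₂ out₁' out₂' : SolitonState m}
    (hc : PairCollision ζ₁ ζ₂ in₁ in₂ out₁ out₂) (hc' : PairCollision ζ₁ ζ₂ in₁ in₂ out₁' out₂') :
    out₁ = out₁' ∧ out₂ = out₂' := by
  obtain ⟨α₁, α₂, u₁, u₂, hu₁, hu₂, rfl, rfl, rfl, rfl⟩ := hc
  obtain ⟨α₁', α₂', u₁', u₂', hu₁', hu₂', e₁, e₂, rfl, rfl⟩ := hc'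
  obtain ⟨rfl, rfl⟩ := SolitonState.mk.inj e₁
  obtain ⟨e₂, e₃⟩ := SolitonState.mk.inj e₂
  rw [pairPol_def, pairPol_def, mul_comm, mul_comm _ (pairFactor ζ₁ ζ₂), mul_smul, mul_smul] at e₃
  have e₄ := smul_right_injective _ (pairFactor_ne_zero h₁ h₂ h) e₃
  simp only [← pairVec_smul] at e₄
  -- The unknown shift also depends on `u₂`; absorbed as a positive scalar, it leaves an injective
  -- linear map applied to a multiple of `u₂`.
  rw [← sub_eq_zero, ← pairVec_sub] at e₄
  have e₅ := sub_eq_zero.mp (eq_zero_of_pairVec_eq_zero h₁ h₂ h hu₁ e₄)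
  -- Both candidates for `u₂` are unit vectors, so comparing norms identifies the two scalars.
  have e₆ := congrArg norm e₅
  rw [norm_smul, norm_smul, hu₂, hu₂', Complex.norm_real, Complex.norm_real,
    Real.norm_of_nonneg (Real.exp_pos _).le, Real.norm_of_nonneg (Real.exp_pos _).le,
    mul_one, mul_one] at e₆
  rw [e₆] at e₅
  have e₇ := smul_right_injective _ (Complex.ofReal_ne_zero.mpr (Real.exp_pos _).ne') e₅
  subst e₇
  have e₈ : α₂ = α₂' := by linarith
  subst e₈
  exact ⟨rfl, rfl⟩

end Pair

/-! ### Elimination steps as collisions. -/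

namespace SolitonData

variable {N m : ℕ} (P : SolitonData N m)

/-- The factor `∏_{l ∈ I} (ζ_l* - ζ_n*) / (ζ_l - ζ_n*)` of the polarization vector `u_{I,n}`. -/
def chi (I : Finset (Fin N)) (n : Fin N) : ℂ := ∏ l ∈ I, pairFactor (P.ζ l) (P.ζ n)

theorem pairFactor_ζ_ne_zero {j k : Fin N} (h : j ≠ k) : pairFactor (P.ζ j) (P.ζ k) ≠ 0 :=
  pairFactor_ne_zero (P.im_pos j) (P.im_pos k) (P.ζ_injective.ne h)

theorem chi_ne_zero {I : Finset (Fin N)} {n : Fin N} (hn : n ∉ I) : P.chi I n ≠ 0 :=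
  Finset.prod_ne_zero_iff.mpr fun _ hl =>
    P.pairFactor_ζ_ne_zero (ne_of_mem_of_not_mem hl hn)

theorem chi_insert {I : Finset (Fin N)} {j : Fin N} (hj : j ∉ I) (k : Fin N) :
    P.chi (insert j I) k = pairFactor (P.ζ j) (P.ζ k) * P.chi I k :=
  Finset.prod_insert hj

variable {P}

namespace IsReduced

variable {I : Finset (Fin N)} {j k n : Fin N} {c e : Fin N → ℂ}

/-- By the pivot formula the quotient of determinants is `‖P.comb c‖ ^ 2`, so `e^{φ}` is precisely
the factor that makes `u_{I,n}` a unit vector. -/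
theorem phi_eq (hc : P.IsReduced I n c) :
    P.phi I n = -Real.log (‖P.chi I n‖ * ‖P.comb c‖) := by
  have h0 := (P.im_pos n).ne'
  have e1 : (P.detD' I n / (P.d n n * P.detD I)).re = ‖P.comb c‖ ^ 2 := by
    have hd := P.detD_ne_zero I
    have h1 : P.detD' I n / (P.d n n * P.detD I) = P.mulD c n / P.d n n := by
      rw [hc.detD'_eq, mul_comm (P.d n n), mul_div_mul_left _ _ hd]
    rw [h1, hc.mulD_self, d_self, ← Complex.ofReal_div, Complex.ofReal_re]
    field_simp
  have e2 : ∏ l ∈ I, ‖(P.ζ l - P.ζ n) / (P.ζ l - conj (P.ζ n))‖ ^ 2 = ‖P.chi I n‖ ^ 2 := by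
    rw [chi, norm_prod, ← Finset.prod_pow]
    simp only [norm_pairFactor]
  rw [phi, e1, e2, ← mul_pow, Real.log_pow]
  push_cast; ring

theorem chi_mul_comb_pos (hc : P.IsReduced I n c) : 0 < ‖P.chi I n‖ * ‖P.comb c‖ :=
  mul_pos (norm_pos_iff.mpr (P.chi_ne_zero hc.not_mem)) hc.norm_comb_pos

theorem exp_phi (hc : P.IsReduced I n c) :
    Real.exp (P.phi I n) = (‖P.chi I n‖ * ‖P.comb c‖)⁻¹ := by
  rw [hc.phi_eq, Real.exp_neg, Real.exp_log hc.chi_mul_comb_pos]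

theorem pol_eq_exp (hc : P.IsReduced I n c) :
    P.pol I n = ((Real.exp (P.phi I n) : ℂ) * P.chi I n) • P.comb c := by
  have hd := P.detD_ne_zero I
  rw [pol, hc.vecDet_eq, smul_smul, div_mul_cancel₀ _ hd]
  rfl

theorem pol_eq (hc : P.IsReduced I n c) :
    P.pol I n = ((((‖P.chi I n‖ * ‖P.comb c‖)⁻¹ : ℝ) : ℂ) * P.chi I n) • P.comb c := by
  rw [hc.pol_eq_exp, hc.exp_phi]

theorem norm_pol (hc : P.IsReduced I n c) : ‖P.pol I n‖ = 1 := by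
  have := hc.chi_mul_comb_pos
  rw [hc.pol_eq, norm_smul, norm_mul, Complex.norm_real, Real.norm_of_nonneg (by positivity)]
  rw [mul_assoc, inv_mul_cancel₀ this.ne']

end IsReduced

variable (P)

theorem norm_pol {I : Finset (Fin N)} {n : Fin N} (hn : n ∉ I) : ‖P.pol I n‖ = 1 := by
  obtain ⟨c, hc⟩ := P.exists_isReduced hn
  exact hc.norm_pol

/-- The state of soliton `k` behind the solitons in `I` and `j` results from its state behind `I`
by a collision with soliton `j` in its state behind `I`. -/
theorem solitonState_insert {I : Finset (Fin N)} {j k : Fin N} (hj : j ∉ I) (hk : k ∉ I)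
    (hjk : j ≠ k) :
    P.phi (insert j I) k =
      P.phi I k + pairShift (P.ζ j) (P.ζ k) (P.pol I j) (P.pol I k) ∧
    P.pol (insert j I) k = pairPol (P.ζ j) (P.ζ k) (P.pol I j) (P.pol I k) := by
  obtain ⟨c, hc⟩ := P.exists_isReduced hj
  obtain ⟨e, he⟩ := P.exists_isReduced hk
  have hi := hc.insert hjk he
  set e' := e - ((P.ζ j - conj (P.ζ j)) / (P.ζ j - conj (P.ζ k)) *
      (hdot (P.comb e) (P.comb c) / (‖P.comb c‖ : ℂ) ^ 2)) • c with he'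
  have hχj : (‖P.chi I j‖ : ℂ) ≠ 0 := by
    exact_mod_cast (norm_pos_iff.mpr (P.chi_ne_zero hj)).ne'
  have hχk := norm_pos_iff.mpr (P.chi_ne_zero hk)
  have hcn : (‖P.comb c‖ : ℂ) ≠ 0 := by exact_mod_cast hc.norm_comb_pos.ne'
  -- The phase of `chi I j` is irrelevant: `P.pol I j` enters once linearly and once conjugated.
  have hw : pairVec (P.ζ j) (P.ζ k) (P.pol I j) (P.pol I k) =
      ((((‖P.chi I k‖ * ‖P.comb e‖)⁻¹ : ℝ) : ℂ) * P.chi I k) • P.comb e' := by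
    rw [he.pol_eq, pairVec_smul]
    congr 1
    rw [pairVec, he', comb_sub, comb_smul, hc.pol_eq, hdot_smul_right, smul_smul]
    congr 2
    have h1 : P.chi I j * conj (P.chi I j) = (‖P.chi I j‖ : ℂ) ^ 2 := by
      rw [Complex.mul_conj, Complex.normSq_eq_norm_sq]; push_cast; rfl
    rw [map_mul, Complex.conj_ofReal]
    push_cast
    have h2 := P.ζ_sub_conj_ne j k
    field_simp
    linear_combination (P.ζ j - conj (P.ζ j)) * hdot (P.comb e) (P.comb c) * h1
  have hwn : ‖pairVec (P.ζ j) (P.ζ k) (P.pol I j) (P.pol I k)‖ = ‖P.comb e'‖ / ‖P.comb e‖ := by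
    have := hχk.ne'
    have := he.norm_comb_pos.ne'
    rw [hw, norm_smul, norm_mul, Complex.norm_real, Real.norm_of_nonneg (by positivity)]
    field_simp
  have hρ := norm_pos_iff.mpr (P.pairFactor_ζ_ne_zero hjk)
  have hs := pairShift_eq (P.im_pos j) (P.im_pos k) hc.norm_pol he.norm_pol
  have hphi : P.phi (insert j I) k =
      P.phi I k + pairShift (P.ζ j) (P.ζ k) (P.pol I j) (P.pol I k) := by
    have h1 := he.norm_comb_pos.ne'
    have h2 := hi.norm_comb_pos.ne'
    rw [hs, hi.phi_eq, he.phi_eq, hwn, ← neg_add, ← Real.log_mul, P.chi_insert hj, norm_mul]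
    · congr 2
      field_simp
    · exact he.chi_mul_comb_pos.ne'
    · exact mul_ne_zero hρ.ne' (div_ne_zero h2 h1)
  refine ⟨hphi, ?_⟩
  rw [hi.pol_eq_exp, hphi, pairPol_def, hw, smul_smul, P.chi_insert hj, Real.exp_add,
    ← he.exp_phi]
  push_cast
  congr 1; ring

/-- The free data of the law are the states of both solitons relative to `I` alone. One elimination
step adds `j` to the set of `k` before the collision, the mirror step adds `k` to the set of `j`
after it, and the two shifts agree by symmetry. -/
theorem pairCollision_solitonState {I : Finset (Fin N)} {j k : Fin N} (hj : j ∉ I) (hk : k ∉ I)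
    (hjk : j ≠ k) :
    PairCollision (P.ζ j) (P.ζ k) (P.solitonState I j) (P.solitonState (insert j I) k)
      (P.solitonState (insert k I) j) (P.solitonState I k) := by
  refine ⟨P.α j + P.phi I j, P.α k + P.phi I k, P.pol I j, P.pol I k, P.norm_pol hj, P.norm_pol hk,
    rfl, ?_, ?_, rfl⟩
  · obtain ⟨h1, h2⟩ := P.solitonState_insert hj hk hjk
    rw [solitonState, h1, h2, add_assoc]
  · obtain ⟨h1, h2⟩ := P.solitonState_insert hk hj hjk.symm
    rw [solitonState, h1, h2, add_assoc, pairShift_comm (P.ζ j)]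

end SolitonData

/-! ### Collision orders; "`a` is left of `b` in `w`" is encoded as `[a, b]` being a sublist of `w`.
-/

section Combinatorics

variable {α : Type*}

theorem pair_sublist_cons {a b x : α} {l : List α} :
    List.Sublist [a, b] (x :: l) ↔ List.Sublist [a, b] l ∨ a = x ∧ b ∈ l := by
  rw [List.cons_sublist_cons', List.singleton_sublist]

/-- Swapping two neighbours changes the relative order of these two entries only. -/
theorem pair_sublist_swap (A B : List α) (k j a b : α) :
    List.Sublist [a, b] (A ++ j :: k :: B) ∨ (a = k ∧ b = j) ↔
      List.Sublist [a, b] (A ++ k :: j :: B) ∨ (a = j ∧ b = k) := by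
  induction A with
  | nil => simp only [List.nil_append, pair_sublist_cons, List.mem_cons]; tauto
  | cons x A ih =>
    simp only [List.cons_append, pair_sublist_cons, List.mem_append, List.mem_cons]
    tauto

theorem not_pair_sublist_of_nodup {w : List α} (hw : w.Nodup) {a b : α}
    (h : List.Sublist [a, b] w) : ¬ List.Sublist [b, a] w := by
  induction w with
  | nil => simp at h
  | cons x w ih =>
    rw [List.nodup_cons] at hw
    rw [pair_sublist_cons] at h ⊢
    rintro (h' | ⟨rfl, h'⟩) <;> rcases h with h | ⟨rfl, h⟩
    · exact ih hw.2 h h'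
    · exact hw.1 (h'.subset (by simp))
    · exact hw.1 (h.subset (by simp))
    · exact hw.1 h

theorem pair_sublist_total {w : List α} {a b : α} (ha : a ∈ w) (hb : b ∈ w) (hab : a ≠ b) :
    List.Sublist [a, b] w ∨ List.Sublist [b, a] w := by
  induction w with
  | nil => simp at ha
  | cons x w ih =>
    simp only [pair_sublist_cons]
    rw [List.mem_cons] at ha hb
    rcases ha with rfl | ha <;> rcases hb with rfl | hb
    · exact absurd rfl hab
    · exact Or.inl (Or.inr ⟨rfl, hb⟩)
    · exact Or.inr (Or.inr ⟨rfl, ha⟩)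
    · rcases ih ha hb with h | h
      · exact Or.inl (Or.inl h)
      · exact Or.inr (Or.inl h)

theorem pair_sublist_append_cons {A B : List α} {n : α} (h : (A ++ n :: B).Nodup) (l : α) :
    List.Sublist [n, l] (A ++ n :: B) ↔ l ∈ B := by
  induction A with
  | nil =>
    rw [List.nil_append, List.nodup_cons] at h
    rw [List.nil_append, pair_sublist_cons]
    constructor
    · rintro (h' | h')
      · exact absurd (h'.subset (by simp)) h.1
      · exact h'.2
    · exact fun h' => Or.inr ⟨rfl, h'⟩
  | cons x A ih =>
    rw [List.cons_append, List.nodup_cons] at h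
    rw [List.cons_append, pair_sublist_cons, ih h.2]
    refine or_iff_left ?_
    rintro ⟨rfl, -⟩
    exact h.1 (by simp)

theorem nodup_swap {A B : List α} {k j : α} :
    (A ++ j :: k :: B).Nodup ↔ (A ++ k :: j :: B).Nodup :=
  (List.Perm.append_left A (List.Perm.swap k j B)).nodup_iff

variable {N : ℕ}

theorem pair_sublist_finRange {a b : Fin N} : List.Sublist [a, b] (List.finRange N) ↔ a < b := by
  have h : ∀ {a b : Fin N}, List.Sublist [a, b] (List.finRange N) → a < b :=
    List.pairwise_iff_forall_sublist.mp (List.pairwise_lt_finRange N)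
  refine ⟨fun hs => h hs, fun hab => ?_⟩
  rcases pair_sublist_total (List.mem_finRange a) (List.mem_finRange b) hab.ne with hs | hs
  · exact hs
  · exact absurd (h hs) hab.asymm

theorem pair_sublist_reverse_finRange {a b : Fin N} :
    List.Sublist [a, b] (List.finRange N).reverse ↔ b < a := by
  rw [← pair_sublist_finRange, ← List.reverse_sublist]
  simp

theorem nodup_reverse_finRange : (List.finRange N).reverse.Nodup :=
  List.nodup_reverse.mpr (List.nodup_finRange N)

theorem Rearranges.perm {L : List (Fin N × Fin N)} {w w' : List (Fin N)}
    (h : Rearranges L w w') : w'.Perm w := by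
  induction h with
  | nil w => exact List.Perm.refl _
  | cons A B k j hjk h ih => exact ih.trans (List.Perm.append_left A (List.Perm.swap k j B))

/-- The collisions of a sequence are distinct and exhaust the inversions of the arrangement that
are not present at the end. -/
theorem Rearranges.collisions {L : List (Fin N × Fin N)} {w w' : List (Fin N)}
    (h : Rearranges L w w') (hw : w.Nodup) :
    L.Nodup ∧ (∀ p ∈ L, p.2 < p.1 ∧ ¬ List.Sublist [p.1, p.2] w') ∧
      ∀ k j, j < k → (List.Sublist [k, j] w ↔ (k, j) ∈ L ∨ List.Sublist [k, j] w') := by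
  induction h with
  | nil w => simp
  | @cons L w' A B k j hjk h ih =>
    have hw' := nodup_swap.mpr hw
    obtain ⟨ih1, ih2, ih3⟩ := ih hw'
    -- Once exchanged, the pair is no longer an inversion, so by induction it neither collides again
    -- nor is inverted at the end.
    have hjk' : ¬ List.Sublist [k, j] (A ++ j :: k :: B) :=
      not_pair_sublist_of_nodup hw' ((pair_sublist_append_cons hw' k).mpr (by simp))
    have hno := hjk'
    rw [ih3 k j hjk, not_or] at hno
    refine ⟨List.nodup_cons.mpr ⟨hno.1, ih1⟩, ?_, ?_⟩
    · intro p hp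
      rcases List.mem_cons.mp hp with rfl | hp
      · exact ⟨hjk, hno.2⟩
      · exact ih2 p hp
    · intro a b hab
      have h1 := pair_sublist_swap A B k j a b
      have h2 : ¬ (a = j ∧ b = k) := fun h => by
        rw [h.1, h.2] at hab; exact absurd hjk hab.asymm
      rw [or_iff_left h2] at h1
      rw [← h1, ih3 a b hab, List.mem_cons, Prod.mk.injEq]
      tauto

theorem eq_finRange_of_complete {w : List (Fin N)} (hw : w.Perm (List.finRange N))
    (h : ¬ ∃ (A B : List (Fin N)) (k j : Fin N), j < k ∧ w = A ++ k :: j :: B) :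
    w = List.finRange N := by
  have hc : w.IsChain (· ≤ ·) := by
    rw [List.isChain_iff_forall_rel_of_append_cons_cons]
    intro a b A B hw
    by_contra hab
    exact h ⟨A, B, a, b, not_le.mp hab, hw⟩
  refine List.Perm.eq_of_pairwise (le := (· ≤ ·)) (fun a b _ _ => le_antisymm) ?_ ?_ hw
  · exact List.isChain_iff_pairwise.mp hc
  · exact (List.pairwise_lt_finRange N).imp le_of_lt

theorem IsCollisionOrder.rearranges {L : List (Fin N × Fin N)} (h : IsCollisionOrder L) :
    Rearranges L (List.finRange N).reverse (List.finRange N) := by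
  obtain ⟨w, hw, hc⟩ := h
  have := eq_finRange_of_complete (hw.perm.trans (List.reverse_perm _)) hc
  rwa [this] at hw

theorem IsCollisionOrder.nodup {L : List (Fin N × Fin N)} (h : IsCollisionOrder L) : L.Nodup :=
  (h.rearranges.collisions nodup_reverse_finRange).1

theorem IsCollisionOrder.mem_iff {L : List (Fin N × Fin N)} (h : IsCollisionOrder L)
    (k j : Fin N) : (k, j) ∈ L ↔ j < k := by
  obtain ⟨-, h2, h3⟩ := h.rearranges.collisions nodup_reverse_finRange
  refine ⟨fun hm => (h2 _ hm).1, fun hjk => ?_⟩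
  have := (h3 k j hjk).mp (pair_sublist_reverse_finRange.mpr hjk)
  rw [pair_sublist_finRange, or_iff_left hjk.asymm] at this
  exact this

/-- Needed for uniqueness, where an evolution brings its own arrangements. A remaining adjacent
inversion would be a pair in `L`, but pairs in `L` are not inverted at the end. -/
theorem IsCollisionOrder.eq_finRange {L : List (Fin N × Fin N)} (h : IsCollisionOrder L)
    {w : List (Fin N)} (hw : Rearranges L (List.finRange N).reverse w) : w = List.finRange N := by
  have hwn : w.Nodup := hw.perm.nodup_iff.mpr nodup_reverse_finRange
  refine eq_finRange_of_complete (hw.perm.trans (List.reverse_perm _)) ?_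
  rintro ⟨A, B, k, j, hjk, rfl⟩
  obtain ⟨-, h2, -⟩ := hw.collisions nodup_reverse_finRange
  exact (h2 _ ((h.mem_iff k j).mpr hjk)).2 ((pair_sublist_append_cons hwn j).mpr (by simp))

theorem IsCollisionOrder.length_eq {L : List (Fin N × Fin N)} (h : IsCollisionOrder L) :
    L.length = N.choose 2 := by
  classical
  rw [← List.toFinset_card_of_nodup h.nodup]
  have h1 : L.toFinset = Finset.univ.filter fun p : Fin N × Fin N => p.2 < p.1 := by
    ext ⟨k, j⟩
    simp [h.mem_iff]
  rw [h1, Finset.card_filter, Fintype.sum_prod_type]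
  have h2 : ∀ k : Fin N, ∑ j : Fin N, (if j < k then 1 else 0) = (k : ℕ) := fun k => by
    rw [← Finset.card_filter, ← Fin.card_Iio k]
    congr 1; ext; simp
  simp only [h2]
  rw [Fin.sum_univ_eq_sum_range (fun i => i), Finset.sum_range_id, Nat.choose_two_right]

/-- Bubble sort terminates: each overtaking strictly reduces the set of inversions. -/
theorem exists_rearranges (w : List (Fin N)) (hw : w.Nodup) :
    ∃ L w', Rearranges L w w' ∧
      ¬ ∃ (A B : List (Fin N)) (k j : Fin N), j < k ∧ w' = A ++ k :: j :: B := by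
  classical
  induction hn : (Finset.univ.filter fun p : Fin N × Fin N =>
      p.2 < p.1 ∧ List.Sublist [p.1, p.2] w).card using Nat.strong_induction_on generalizing w with
  | _ n ih =>
    by_cases h : ∃ (A B : List (Fin N)) (k j : Fin N), j < k ∧ w = A ++ k :: j :: B
    · obtain ⟨A, B, k, j, hjk, rfl⟩ := h
      have hw' := nodup_swap.mpr hw
      obtain ⟨L, w', hL, hw''⟩ := ih _ (by
        rw [← hn]
        apply Finset.card_lt_card
        rw [Finset.ssubset_iff]
        refine ⟨(k, j), ?_, ?_⟩
        · simp only [Finset.mem_filter, Finset.mem_univ, true_and, not_and]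
          exact fun _ =>
            not_pair_sublist_of_nodup hw' ((pair_sublist_append_cons hw' k).mpr (by simp))
        · rw [Finset.insert_subset_iff]
          constructor
          · simp only [Finset.mem_filter, Finset.mem_univ, true_and]
            exact ⟨hjk, (pair_sublist_append_cons hw j).mpr (by simp)⟩
          · rintro ⟨a, b⟩ hp
            simp only [Finset.mem_filter, Finset.mem_univ, true_and] at hp ⊢
            refine ⟨hp.1, ?_⟩
            rcases (pair_sublist_swap A B k j a b).mp (Or.inl hp.2) with h | h
            · exact h
            · rw [h.1, h.2] at hp; exact absurd hjk hp.1.asymm) (A ++ j :: k :: B) hw' rfl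
      exact ⟨(k, j) :: L, w', Rearranges.cons A B k j hjk hL, hw''⟩
    · exact ⟨[], w, Rearranges.nil w, h⟩

theorem exists_isCollisionOrder (N : ℕ) : ∃ L : List (Fin N × Fin N), IsCollisionOrder L := by
  obtain ⟨L, w, h⟩ := exists_rearranges (List.finRange N).reverse nodup_reverse_finRange
  exact ⟨L, w, h⟩

end Combinatorics

/-! ### Factorization into pair collisions. -/

namespace SolitonData

variable {N m : ℕ} (P : SolitonData N m)

/-- The entries of the arrangement `w` to the right of `n`. -/
def rightOf (w : List (Fin N)) (n : Fin N) : Finset (Fin N) :=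
  Finset.univ.filter fun l => List.Sublist [n, l] w

/-- The configuration with arrangement `w` in which every soliton is in the state belonging to the
set of solitons to its right. -/
def arranged (w : List (Fin N)) : Config N m where
  order := w
  state n := P.solitonState (rightOf w n) n

theorem mem_rightOf {w : List (Fin N)} {n l : Fin N} :
    l ∈ rightOf w n ↔ List.Sublist [n, l] w := by simp [rightOf]

theorem rightOf_append_cons {A B : List (Fin N)} {n : Fin N} (h : (A ++ n :: B).Nodup) :
    rightOf (A ++ n :: B) n = B.toFinset := by
  ext l; rw [mem_rightOf, pair_sublist_append_cons h, List.mem_toFinset]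

theorem rightOf_append_cons_cons {A B : List (Fin N)} {x n : Fin N}
    (h : (A ++ x :: n :: B).Nodup) : rightOf (A ++ x :: n :: B) n = B.toFinset := by
  have := rightOf_append_cons (A := A ++ [x]) (B := B) (n := n) (by simpa using h)
  simpa using this

theorem rightOf_swap {A B : List (Fin N)} {k j i : Fin N} (hj : i ≠ j) (hk : i ≠ k) :
    rightOf (A ++ j :: k :: B) i = rightOf (A ++ k :: j :: B) i := by
  ext l
  simpa [mem_rightOf, hj, hk] using pair_sublist_swap A B k j i l

theorem arranged_reverse_finRange : P.arranged (List.finRange N).reverse = P.initialConfig := by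
  have : ∀ n : Fin N, rightOf (List.finRange N).reverse n = Finset.Iio n := fun n => by
    ext l; simp [mem_rightOf, pair_sublist_reverse_finRange]
  simp only [arranged, initialConfig, this]

theorem arranged_finRange : P.arranged (List.finRange N) = P.finalConfig := by
  have : ∀ n : Fin N, rightOf (List.finRange N) n = Finset.Ioi n := fun n => by
    ext l; simp [mem_rightOf, pair_sublist_finRange]
  simp only [arranged, finalConfig, this]

theorem pairCollision_arranged {A B : List (Fin N)} {k j : Fin N}
    (hw : (A ++ k :: j :: B).Nodup) :
    PairCollision (P.ζ j) (P.ζ k) ((P.arranged (A ++ k :: j :: B)).state j)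
      ((P.arranged (A ++ k :: j :: B)).state k) ((P.arranged (A ++ j :: k :: B)).state j)
      ((P.arranged (A ++ j :: k :: B)).state k) := by
  have hw' := nodup_swap.mpr hw
  have h1 := (List.nodup_append.mp hw).2.1
  rw [List.nodup_cons, List.nodup_cons, List.mem_cons, not_or] at h1
  simp only [arranged]
  rw [rightOf_append_cons_cons hw, rightOf_append_cons hw, rightOf_append_cons_cons hw',
    rightOf_append_cons hw', List.toFinset_cons, List.toFinset_cons]
  exact P.pairCollision_solitonState (by simpa using h1.2.1) (by simpa using h1.1.2)
    (Ne.symm h1.1.1)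

theorem evolves_arranged {L : List (Fin N × Fin N)} {w w' : List (Fin N)}
    (h : Rearranges L w w') (hw : w.Nodup) : P.Evolves L (P.arranged w) (P.arranged w') := by
  induction h with
  | nil w => exact Evolves.nil _
  | cons A B k j hjk h ih =>
    refine Evolves.cons A B k j _ (P.arranged (A ++ j :: k :: B)).state hjk
      (P.pairCollision_arranged hw) ?_ (ih (nodup_swap.mpr hw))
    intro i hij hik
    simp only [arranged, rightOf_swap hij hik]

/-- Determinism: injectivity of the law leaves no choice of states, so the invariant "state indexed
by the solitons to the right" holds along every evolution starting from it. -/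
theorem Evolves.eq_arranged {L : List (Fin N × Fin N)} {c c' : Config N m}
    (h : P.Evolves L c c') (hw : c.order.Nodup) (hc : c = P.arranged c.order) :
    c' = P.arranged c'.order ∧ Rearranges L c.order c'.order := by
  induction h with
  | nil c => exact ⟨hc, Rearranges.nil _⟩
  | @cons L c' A B k j s s' hjk hcoll hrest h ih =>
    have hs : s = (P.arranged (A ++ k :: j :: B)).state := (Config.mk.inj hc).2
    have hs' : s' = (P.arranged (A ++ j :: k :: B)).state := by
      subst hs
      obtain ⟨e1, e2⟩ := hcoll.unique (P.im_pos j) (P.im_pos k) (P.ζ_injective.ne hjk.ne)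
        (P.pairCollision_arranged hw)
      funext i
      by_cases hij : i = j
      · rw [hij, e1]
      by_cases hik : i = k
      · rw [hik, e2]
      rw [hrest i hij hik]
      simp only [arranged, rightOf_swap hij hik]
    obtain ⟨h1, h2⟩ := ih (nodup_swap.mpr hw) (by rw [hs']; rfl)
    exact ⟨h1, Rearranges.cons A B k j hjk h2⟩

theorem evolves_iff {L : List (Fin N × Fin N)} (hL : IsCollisionOrder L) (c : Config N m) :
    P.Evolves L P.initialConfig c ↔ c = P.finalConfig := by
  rw [← arranged_reverse_finRange, ← arranged_finRange]
  constructor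
  · intro h
    obtain ⟨h1, h2⟩ := h.eq_arranged P nodup_reverse_finRange rfl
    have h3 := hL.eq_finRange h2
    rw [h1, h3]
  · rintro rfl
    exact P.evolves_arranged hL.rearranges nodup_reverse_finRange

/-! ### The compactified linear system. -/

/-- The one-component data with the same eigenvalues; its matrix `d` is the Cauchy matrix
`i / (ζ_k - ζ_j*)`. -/
def scalar : SolitonData N 1 where
  ζ := P.ζ
  α := 0
  u _ := EuclideanSpace.single 0 1
  im_pos := P.im_pos
  norm_u _ := by simp
  re_strictAnti := P.re_strictAnti

theorem scalar_d (j k : Fin N) : P.scalar.d j k = Complex.I / (P.ζ k - conj (P.ζ j)) := by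
  simp [d, scalar, hdot_eq_sum]

theorem scalar_comb (c : Fin N → ℂ) : P.scalar.comb c = EuclideanSpace.single 0 (∑ l, c l) := by
  ext i
  fin_cases i
  simp [comb, scalar]

/-- The column vector `d x`. -/
def dMul (x : Fin N → ℂ) (j : Fin N) : ℂ := ∑ k, P.d j k * x k

theorem dMul_eq_conj (x : Fin N → ℂ) (j : Fin N) :
    P.dMul x j = conj (P.mulD (fun k => conj (x k)) j) := by
  simp [dMul, mulD, conj_d, mul_comm]

theorem dMul_add (x y : Fin N → ℂ) (j : Fin N) :
    P.dMul (x + y) j = P.dMul x j + P.dMul y j := by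
  simp [dMul, mul_add, Finset.sum_add_distrib]

theorem dMul_smul (c : ℂ) (x : Fin N → ℂ) (j : Fin N) :
    P.dMul (c • x) j = c * P.dMul x j := by
  simp only [dMul, Finset.mul_sum, Pi.smul_apply, smul_eq_mul]
  exact Finset.sum_congr rfl fun k _ => by ring

theorem sum_mul_dMul (x y : Fin N → ℂ) : ∑ j, x j * P.dMul y j = ∑ k, P.mulD x k * y k := by
  simp only [dMul, mulD, Finset.mul_sum, Finset.sum_mul]
  rw [Finset.sum_comm]
  exact Finset.sum_congr rfl fun j _ => Finset.sum_congr rfl fun k _ => by ring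

theorem formD_re_nonneg (x : Fin N → ℂ) : 0 ≤ (P.formD x x).re := by
  by_cases h : x = 0
  · simp [h, formD]
  · exact (P.posOn Finset.univ x (by simp) h).le

theorem eq_zero_of_formD_re (x : Fin N → ℂ) (hx : (P.formD x x).re = 0) : x = 0 := by
  by_contra h
  exact (P.posOn Finset.univ x (by simp) h).ne' hx

/-- The matrix of the compactified linear system of the `N`-soliton solution. The variables
`s ∈ [0,1]^N` stand for the envelopes, the unimodular numbers `F` for the carrier waves. -/
def sysMat (s : Fin N → ℝ) (F : Fin N → ℂ) : Matrix (Fin N ⊕ Fin N) (Fin N ⊕ Fin N) ℂ :=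
  Matrix.fromBlocks (Matrix.diagonal fun l => (s l : ℂ))
    (Matrix.of fun l k => (1 - s l) * F l * P.d l k)
    (Matrix.of fun l k => -((1 - s l) * conj (F l) * P.scalar.d k l))
    (Matrix.diagonal fun l => (s l : ℂ))

/-- The right-hand side of the compactified linear system. -/
def sysRhs (s : Fin N → ℝ) (F : Fin N → ℂ) (a : Fin m) : Fin N ⊕ Fin N → ℂ :=
  Sum.elim (fun l => (1 - s l) * F l * P.u l a) 0

theorem sysMat_mulVec_inl (s : Fin N → ℝ) (F : Fin N → ℂ) (v p : Fin N → ℂ) (l : Fin N) :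
    (P.sysMat s F).mulVec (Sum.elim v p) (Sum.inl l) =
      s l * v l + (1 - s l) * F l * P.dMul p l := by
  rw [sysMat, Matrix.fromBlocks_mulVec]
  simp only [Sum.elim_inl, Pi.add_apply, Matrix.mulVec_diagonal, Function.comp_def, Sum.elim_inr]
  congr 1
  simp [Matrix.mulVec, dotProduct, dMul, Finset.mul_sum, mul_assoc]

theorem sysMat_mulVec_inr (s : Fin N → ℝ) (F : Fin N → ℂ) (v p : Fin N → ℂ) (l : Fin N) :
    (P.sysMat s F).mulVec (Sum.elim v p) (Sum.inr l) =
      s l * p l - (1 - s l) * conj (F l) * P.scalar.mulD v l := by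
  rw [sysMat, Matrix.fromBlocks_mulVec]
  simp only [Sum.elim_inl, Pi.add_apply, Matrix.mulVec_diagonal, Function.comp_def, Sum.elim_inr]
  rw [add_comm, sub_eq_add_neg]
  congr 1
  simp only [Matrix.mulVec, dotProduct, mulD, Finset.mul_sum, Matrix.of_apply,
    ← Finset.sum_neg_distrib]
  exact Finset.sum_congr rfl fun k _ => by ring

theorem conj_mul_of_norm_one {z : ℂ} (h : ‖z‖ = 1) : conj z * z = 1 := by
  rw [mul_comm, Complex.mul_conj, Complex.normSq_eq_norm_sq, h]; simp

/-- Energy argument: eliminating `s l` from the two equations at each `l` and summing shows that two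
nonnegative forms, that of `d` at `p*` and that of the Cauchy matrix at `v`, add up to zero. Both
are definite. No bound on `s` is needed. -/
theorem sys_injective {s : Fin N → ℝ} {F : Fin N → ℂ} (hF : ∀ l, ‖F l‖ = 1) {v p : Fin N → ℂ}
    (h1 : ∀ l, s l * v l + (1 - s l) * F l * P.dMul p l = 0)
    (h2 : ∀ l, s l * p l - (1 - s l) * conj (F l) * P.scalar.mulD v l = 0) : v = 0 ∧ p = 0 := by
  have key : ∀ l, conj (p l) * P.dMul p l + conj (P.scalar.mulD v l * conj (v l)) = 0 := by
    intro l
    -- At `s l = 1` the equations give `v l = p l = 0` directly; otherwise the factor `1 - s l` can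
    -- be cancelled.
    by_cases hl : s l = 1
    · have e1 := h1 l
      have e2 := h2 l
      rw [hl] at e1 e2
      have e3 : v l = 0 := by simpa using e1
      have e4 : p l = 0 := by simpa using e2
      simp [e3, e4]
    · have hne : (1 - s l : ℂ) ≠ 0 := by
        rw [sub_ne_zero]; exact_mod_cast Ne.symm hl
      have e2 := congrArg conj (h2 l)
      simp only [map_sub, map_mul, Complex.conj_ofReal, map_one, map_zero, Complex.conj_conj] at e2
      rw [map_mul, Complex.conj_conj]
      have hFl := conj_mul_of_norm_one (hF l)
      apply mul_left_cancel₀ hne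
      linear_combination (conj (F l) * conj (p l)) * h1 l - conj (F l) * v l * e2
        - ((1 - s l) * conj (p l) * P.dMul p l
          + (1 - s l) * v l * conj (P.scalar.mulD v l)) * hFl
  have hsum : conj (P.formD (fun k => conj (p k)) (fun k => conj (p k)))
      + conj (P.scalar.formD v v) = 0 := by
    rw [formD, formD, map_sum, map_sum, ← Finset.sum_add_distrib]
    refine Finset.sum_eq_zero fun l _ => ?_
    rw [← key l, dMul_eq_conj]
    simp [mul_comm]
  have hre := congrArg Complex.re hsum
  simp only [Complex.add_re, Complex.conj_re, Complex.zero_re] at hre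
  have n1 := P.formD_re_nonneg (fun k => conj (p k))
  have n2 := P.scalar.formD_re_nonneg v
  have z1 := P.eq_zero_of_formD_re _ (le_antisymm (by linarith) n1)
  have z2 := P.scalar.eq_zero_of_formD_re _ (le_antisymm (by linarith) n2)
  refine ⟨z2, funext fun l => ?_⟩
  simpa using congrFun z1 l

theorem sysMat_det_ne_zero {s : Fin N → ℝ} {F : Fin N → ℂ} (hF : ∀ l, ‖F l‖ = 1) :
    (P.sysMat s F).det ≠ 0 := by
  intro h0
  obtain ⟨z, hz, h⟩ := Matrix.exists_mulVec_eq_zero_iff.mpr h0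
  apply hz
  have hz' : z = Sum.elim (fun l => z (Sum.inl l)) (fun l => z (Sum.inr l)) := by
    ext i; cases i <;> rfl
  rw [hz'] at h
  obtain ⟨e1, e2⟩ := P.sys_injective hF (v := fun l => z (Sum.inl l))
    (p := fun l => z (Sum.inr l))
    (fun l => (P.sysMat_mulVec_inl s F _ _ l).symm.trans (congrFun h (Sum.inl l)))
    (fun l => (P.sysMat_mulVec_inr s F _ _ l).symm.trans (congrFun h (Sum.inr l)))
  rw [hz', e1, e2]
  ext i; cases i <;> rfl

/-- The `N`-soliton solution as a function of the compactified variables. -/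
def sysSol (s : Fin N → ℝ) (F : Fin N → ℂ) : EuclideanSpace ℂ (Fin m) :=
  WithLp.toLp 2 fun a => 2 * ∑ j, ((P.sysMat s F)⁻¹.mulVec (P.sysRhs s F a)) (Sum.inl j)

theorem sysSol_eq {s : Fin N → ℝ} {F : Fin N → ℂ} (hF : ∀ l, ‖F l‖ = 1) (a : Fin m)
    {v p : Fin N → ℂ}
    (h1 : ∀ l, s l * v l + (1 - s l) * F l * P.dMul p l = (1 - s l) * F l * P.u l a)
    (h2 : ∀ l, s l * p l - (1 - s l) * conj (F l) * P.scalar.mulD v l = 0) :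
    P.sysSol s F a = 2 * ∑ j, v j := by
  have hdet := isUnit_iff_ne_zero.mpr (P.sysMat_det_ne_zero (s := s) hF)
  have h : (P.sysMat s F).mulVec (Sum.elim v p) = P.sysRhs s F a := by
    ext i
    cases i with
    | inl l => rw [sysMat_mulVec_inl, h1]; rfl
    | inr l => rw [sysMat_mulVec_inr, h2]; rfl
  rw [sysSol, PiLp.toLp_apply, ← h, Matrix.mulVec_mulVec, Matrix.nonsing_inv_mul _ hdet,
    Matrix.one_mulVec]
  rfl

/-- The compact domain of the compactified variables. -/
def sysDomain (N : ℕ) : Set ((Fin N → ℝ) × (Fin N → ℂ)) :=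
  (Set.univ.pi fun _ => Set.Icc (0 : ℝ) 1) ×ˢ (Set.univ.pi fun _ => Metric.sphere (0 : ℂ) 1)

theorem isCompact_sysDomain : IsCompact (sysDomain N) :=
  (isCompact_univ_pi fun _ => isCompact_Icc).prod (isCompact_univ_pi fun _ => isCompact_sphere _ _)

theorem mem_sysDomain {z : (Fin N → ℝ) × (Fin N → ℂ)} :
    z ∈ sysDomain N ↔ (∀ l, z.1 l ∈ Set.Icc (0 : ℝ) 1) ∧ ∀ l, ‖z.2 l‖ = 1 := by
  simp [sysDomain, Set.mem_prod, Set.mem_pi, -Set.pi_univ_Icc]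

theorem continuous_sysMat : Continuous fun z : (Fin N → ℝ) × (Fin N → ℂ) => P.sysMat z.1 z.2 := by
  refine continuous_matrix fun i j => ?_
  rcases i with i | i <;> rcases j with j | j <;>
    simp only [sysMat, Matrix.fromBlocks_apply₁₁, Matrix.fromBlocks_apply₁₂,
      Matrix.fromBlocks_apply₂₁, Matrix.fromBlocks_apply₂₂, Matrix.of_apply,
      Matrix.diagonal_apply]
  · split_ifs <;> fun_prop
  · fun_prop
  · fun_prop
  · split_ifs <;> fun_prop

theorem continuous_sysRhs (a : Fin m) (i : Fin N ⊕ Fin N) :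
    Continuous fun z : (Fin N → ℝ) × (Fin N → ℂ) => P.sysRhs z.1 z.2 a i := by
  cases i <;> simp only [sysRhs, Sum.elim_inl, Sum.elim_inr, Pi.zero_apply] <;> fun_prop

/-- The source of uniformity in `x`: the determinant has no zero on a compact domain, so the inverse
is continuous there by the adjugate formula, and Heine–Cantor applies. -/
theorem uniformContinuousOn_sysSol :
    UniformContinuousOn (fun z : (Fin N → ℝ) × (Fin N → ℂ) => P.sysSol z.1 z.2)
      (sysDomain N) := by
  refine isCompact_sysDomain.uniformContinuousOn_of_continuous ?_
  refine (PiLp.continuous_toLp 2 _).comp_continuousOn (continuousOn_pi.mpr fun a => ?_)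
  refine continuousOn_const.mul (continuousOn_finsetSum _ fun j _ => ?_)
  simp only [Matrix.mulVec, dotProduct]
  refine continuousOn_finsetSum _ fun i _ => ?_
  refine ContinuousOn.mul ?_ (P.continuous_sysRhs a i).continuousOn
  simp only [Matrix.inv_def, Ring.inverse_eq_inv', Matrix.smul_apply, smul_eq_mul]
  refine ContinuousOn.mul ?_ ?_
  · refine ContinuousOn.inv₀ P.continuous_sysMat.matrix_det.continuousOn fun z hz => ?_
    exact P.sysMat_det_ne_zero (mem_sysDomain.mp hz).2
  · exact (P.continuous_sysMat.matrix_adjugate.matrix_elem _ _).continuousOn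

/-- The envelope variable `σ_l = e^{τ_l + α_l} / (2 η_l)`. -/
def sigma (l : Fin N) (x t : ℝ) : ℝ := Real.exp (tau (P.ζ l) x t + P.α l) / (2 * (P.ζ l).im)

/-- The carrier wave `F_l = e^{-iΘ_l}`. -/
def carrier (l : Fin N) (x t : ℝ) : ℂ := Complex.exp (-Complex.I * Theta (P.ζ l) x t)

/-- The compactified envelope variable. -/
def envel (l : Fin N) (x t : ℝ) : ℝ := P.sigma l x t / (1 + P.sigma l x t)

theorem sigma_pos (l : Fin N) (x t : ℝ) : 0 < P.sigma l x t := by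
  have := P.im_pos l
  unfold sigma; positivity

theorem norm_carrier (l : Fin N) (x t : ℝ) : ‖P.carrier l x t‖ = 1 := by
  rw [carrier, neg_mul, mul_comm, ← neg_mul, ← Complex.ofReal_neg, Complex.norm_exp_ofReal_mul_I]

theorem conj_carrier (l : Fin N) (x t : ℝ) :
    conj (P.carrier l x t) = Complex.exp (Complex.I * Theta (P.ζ l) x t) := by
  rw [carrier, ← Complex.exp_conj]; simp

theorem envel_mem (l : Fin N) (x t : ℝ) : P.envel l x t ∈ Set.Icc (0 : ℝ) 1 := by
  have := P.sigma_pos l x t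
  refine ⟨by unfold envel; positivity, ?_⟩
  rw [envel, div_le_one (by positivity)]; linarith

theorem one_sub_envel (l : Fin N) (x t : ℝ) :
    1 - P.envel l x t = 1 / (1 + P.sigma l x t) := by
  have := P.sigma_pos l x t
  rw [envel]; field_simp; ring

/-- The coefficient `lam` factors into an entry of `d` and one of the Cauchy matrix; the minus sign
is the product of the two factors `i`. -/
theorem U_apply (x t : ℝ) (j k : Fin N) : P.U x t j k =
    (if j = k then (P.sigma j x t : ℂ) else 0) + ∑ l, P.carrier j x t * P.d j l *
      ((P.sigma l x t : ℂ)⁻¹ * conj (P.carrier l x t)) * P.scalar.d k l := by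
  rw [U, Matrix.of_apply]
  congr 1
  · congr 1
    rw [sigma]; push_cast; rfl
  · refine Finset.sum_congr rfl fun l _ => ?_
    have h1 := P.ζ_sub_conj_ne l j
    have h2 := P.ζ_sub_conj_ne l k
    have h3 : ((P.ζ l).im : ℂ) ≠ 0 := by exact_mod_cast (P.im_pos l).ne'
    have e1 : Complex.exp (-((tau (P.ζ l) x t + P.α l : ℝ) : ℂ)
      + Complex.I * ((Theta (P.ζ l) x t - Theta (P.ζ j) x t : ℝ) : ℂ)) =
      (Complex.exp ((tau (P.ζ l) x t + P.α l : ℝ) : ℂ))⁻¹ * P.carrier j x t *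
        conj (P.carrier l x t) := by
      rw [conj_carrier, carrier, ← Complex.exp_neg, ← Complex.exp_add, ← Complex.exp_add]
      congr 1; push_cast; ring
    have e2 := Complex.exp_ne_zero ((tau (P.ζ l) x t + P.α l : ℝ) : ℂ)
    rw [e1, lam, scalar_d, d, sigma, Complex.ofReal_div, Complex.ofReal_exp]
    push_cast at e2 ⊢
    field_simp
    linear_combination (-hdot (P.u j) (P.u l) * P.carrier j x t *
        conj (P.carrier l x t)) * Complex.I_sq

theorem U_mulVec (x t : ℝ) (v : Fin N → ℂ) (l : Fin N) :
    (P.U x t).mulVec v l = P.sigma l x t * v l + P.carrier l x t *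
      P.dMul (fun k => (P.sigma k x t : ℂ)⁻¹ * conj (P.carrier k x t) * P.scalar.mulD v k) l := by
  simp only [Matrix.mulVec, dotProduct, U_apply, add_mul, Finset.sum_add_distrib, dMul, mulD,
    Finset.mul_sum, Finset.sum_mul]
  congr 1
  · simp
  · rw [Finset.sum_comm]
    exact Finset.sum_congr rfl fun i _ => Finset.sum_congr rfl fun k _ => by ring

/-- The auxiliary unknown is the inner factor of `U v`. Dividing each equation by `1 + σ_l` leaves
coefficients that stay bounded as `σ_l` tends to `0` or infinity. -/
theorem sys_of_U_mulVec {x t : ℝ} {v b : Fin N → ℂ}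
    (h : (P.U x t).mulVec v = fun l => P.carrier l x t * b l) :
    (∀ l, P.envel l x t * v l + (1 - P.envel l x t) * P.carrier l x t * P.dMul
        (fun k => (P.sigma k x t : ℂ)⁻¹ * conj (P.carrier k x t) * P.scalar.mulD v k) l
      = (1 - P.envel l x t) * P.carrier l x t * b l) ∧
    ∀ l, P.envel l x t * ((P.sigma l x t : ℂ)⁻¹ * conj (P.carrier l x t) * P.scalar.mulD v l)
      - (1 - P.envel l x t) * conj (P.carrier l x t) * P.scalar.mulD v l = 0 := by
  have hσ : ∀ l, (P.sigma l x t : ℂ) ≠ 0 := fun l => by exact_mod_cast (P.sigma_pos l x t).ne'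
  have hσ' : ∀ l, (1 + P.sigma l x t : ℂ) ≠ 0 := fun l => by
    have := P.sigma_pos l x t
    exact_mod_cast (by positivity : (1 + P.sigma l x t) ≠ 0)
  have he : ∀ l, (P.envel l x t : ℂ) = P.sigma l x t / (1 + P.sigma l x t) := fun l => by
    rw [envel]; push_cast; rfl
  have he' : ∀ l, (1 - P.envel l x t : ℂ) = 1 / (1 + P.sigma l x t) := fun l => by
    exact_mod_cast congrArg Complex.ofReal (P.one_sub_envel l x t)
  refine ⟨fun l => ?_, fun l => ?_⟩
  · have h1 := congrFun h l
    rw [U_mulVec] at h1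
    rw [he', he]
    linear_combination (1 / (1 + P.sigma l x t) : ℂ) * h1
  · rw [he', he]
    have := hσ l
    have := hσ' l
    field_simp
    ring

theorem det_U_ne_zero (x t : ℝ) : (P.U x t).det ≠ 0 := by
  intro h0
  obtain ⟨v, hv, h⟩ := Matrix.exists_mulVec_eq_zero_iff.mpr h0
  obtain ⟨h1, h2⟩ := P.sys_of_U_mulVec (b := 0) (v := v) (x := x) (t := t)
    (by rw [h]; ext l; simp)
  refine hv (P.sys_injective (fun l => P.norm_carrier l x t)
    (v := v) (p := _) ?_ h2).1
  intro l
  rw [h1 l]; simp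

theorem q_apply (x t : ℝ) (a : Fin m) :
    P.q x t a = 2 * ∑ j, (P.U x t)⁻¹.mulVec (fun k => P.carrier k x t * P.u k a) j := by
  simp [q, Matrix.mulVec, dotProduct, carrier, mul_assoc]

theorem q_eq_sysSol (x t : ℝ) :
    P.q x t = P.sysSol (fun l => P.envel l x t) (fun l => P.carrier l x t) := by
  ext a
  have hdet := isUnit_iff_ne_zero.mpr (P.det_U_ne_zero x t)
  obtain ⟨h1, h2⟩ := P.sys_of_U_mulVec (x := x) (t := t) (b := fun k => P.u k a)
    (v := (P.U x t)⁻¹.mulVec (fun k => P.carrier k x t * P.u k a))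
    (by rw [Matrix.mulVec_mulVec, Matrix.mul_nonsing_inv _ hdet, Matrix.one_mulVec])
  rw [P.sysSol_eq (fun l => P.norm_carrier l x t) a h1 h2, q_apply]

/-- For the Cauchy matrix the reduced vectors are given by a product. -/
theorem sum_eq_chi {I : Finset (Fin N)} {n : Fin N} {c : Fin N → ℂ}
    (hc : P.scalar.IsReduced I n c) : ∑ l, c l = P.chi I n := by
  induction I using Finset.induction_on generalizing n c with
  | empty =>
    rw [Finset.sum_eq_single n (fun l _ hl => hc.apply_of_not_mem l hl (by simp)) (by simp),
      hc.apply_self]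
    simp [chi]
  | insert j I hj ih =>
    have hn := hc.not_mem
    rw [Finset.mem_insert, not_or] at hn
    obtain ⟨e, he⟩ := P.scalar.exists_isReduced hn.2
    obtain ⟨f, hf⟩ := P.scalar.exists_isReduced hj
    -- In one component an elimination step is multiplication by the scalar `1 - (ζ_j - ζ_j*)/(ζ_j -
    -- ζ_n*)`, which is `pairFactor`.
    rw [hc.unique (hf.insert (Ne.symm hn.1) he), P.chi_insert hj, ← ih he]
    simp only [Pi.sub_apply, Pi.smul_apply, Finset.sum_sub_distrib, smul_eq_mul, ← Finset.mul_sum]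
    have h0 : P.chi I j ≠ 0 := P.chi_ne_zero hj
    have h1 := P.ζ_sub_conj_ne j n
    rw [scalar_comb, scalar_comb, ih he, ih hf]
    have h2 : hdot (EuclideanSpace.single (0 : Fin 1) (P.chi I n))
        (EuclideanSpace.single (0 : Fin 1) (P.chi I j)) = P.chi I n * conj (P.chi I j) := by
      simp [hdot_eq_sum]
    have h3 : (‖EuclideanSpace.single (0 : Fin 1) (P.chi I j)‖ : ℂ) ^ 2 =
        P.chi I j * conj (P.chi I j) := by
      rw [Complex.mul_conj, Complex.normSq_eq_norm_sq]; simp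
    have h4 : conj (P.chi I j) ≠ 0 := (map_ne_zero _).mpr h0
    rw [h2, h3, pairFactor]
    change _ - (P.ζ j - conj (P.ζ j)) / (P.ζ j - conj (P.ζ n)) * _ * _ = _
    field_simp
    ring

/-- Solvability of the linear system of a principal submatrix of `d`. -/
theorem exists_dMul_eq (I : Finset (Fin N)) (b : Fin N → ℂ) :
    ∃ p : Fin N → ℂ, (∀ l ∉ I, p l = 0) ∧ ∀ l ∈ I, P.dMul p l = b l := by
  set M := Matrix.of fun r c : I => P.d r c with hM
  have hdet : IsUnit M.det := isUnit_iff_ne_zero.mpr (P.detD_ne_zero I)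
  set a := M⁻¹.mulVec fun k : I => b k with ha
  have haM : M.mulVec a = fun k : I => b k := by
    rw [ha, Matrix.mulVec_mulVec, Matrix.mul_nonsing_inv _ hdet, Matrix.one_mulVec]
  refine ⟨fun l => if h : l ∈ I then a ⟨l, h⟩ else 0, fun l hl => by simp [hl], fun l hl => ?_⟩
  rw [← congrFun haM ⟨l, hl⟩, dMul, ← Finset.sum_subset (Finset.subset_univ I),
    ← Finset.sum_coe_sort]
  · simp [Matrix.mulVec, dotProduct, hM]
  · intro k _ hk; simp [hk]

/-- The one-soliton wave in terms of exponentials. -/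
theorem wave_solitonState {I : Finset (Fin N)} {n : Fin N} {c : Fin N → ℂ}
    (hc : P.IsReduced I n c) (x t : ℝ) (a : Fin m) :
    wave (P.ζ n) (P.solitonState I n) x t a =
      2 * ((P.sigma n x t / (P.sigma n x t ^ 2 + ‖P.comb c‖ ^ 2 / (2 * (P.ζ n).im) *
        (‖P.chi I n‖ ^ 2 / (2 * (P.ζ n).im))) : ℝ) : ℂ) * P.carrier n x t * P.chi I n *
        P.comb c a := by
  have hη := P.im_pos n
  have hr := hc.chi_mul_comb_pos
  have key : 2 * (P.ζ n).im * (Real.cosh (tau (P.ζ n) x t + (P.α n + P.phi I n)))⁻¹ *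
      Real.exp (P.phi I n) = 2 * (P.sigma n x t / (P.sigma n x t ^ 2 +
        ‖P.comb c‖ ^ 2 / (2 * (P.ζ n).im) * (‖P.chi I n‖ ^ 2 / (2 * (P.ζ n).im)))) := by
    have h1 := Real.exp_pos (tau (P.ζ n) x t + P.α n)
    rw [Real.cosh_eq, ← add_assoc, neg_add, Real.exp_add, Real.exp_add (-(_ + _)), Real.exp_neg,
      Real.exp_neg (P.phi I n), hc.exp_phi, sigma]
    have h2 : ‖P.comb c‖ ^ 2 / (2 * (P.ζ n).im) * (‖P.chi I n‖ ^ 2 / (2 * (P.ζ n).im)) =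
      (‖P.chi I n‖ * ‖P.comb c‖) ^ 2 / (2 * (P.ζ n).im) ^ 2 := by
      field_simp
    rw [h2]
    generalize ‖P.chi I n‖ * ‖P.comb c‖ = r at hr
    generalize Real.exp (tau (P.ζ n) x t + P.α n) = e at h1
    field_simp
  rw [wave, PiLp.smul_apply, smul_eq_mul]
  have h3 : (P.solitonState I n).pol a = (Real.exp (P.phi I n) : ℂ) * P.chi I n * P.comb c a := by
    rw [solitonState, hc.pol_eq_exp]; rfl
  have h4 : (P.solitonState I n).phase = P.α n + P.phi I n := rfl
  have keyC := congrArg Complex.ofReal key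
  rw [Complex.ofReal_mul, Complex.ofReal_mul 2 (_ / _)] at keyC
  rw [h3, h4, carrier]
  push_cast at keyC ⊢
  linear_combination (Complex.exp (-Complex.I * Theta (P.ζ n) x t) * P.chi I n * P.comb c a) * keyC

/-- In the limit in which the solitons in `I` are on the far right and those not in `I` and
different from `n` on the far left, the solution is a one-soliton wave. -/
theorem sysSol_eq_wave {I : Finset (Fin N)} {n : Fin N} (hn : n ∉ I) (x t : ℝ) :
    P.sysSol (fun l => if l = n then P.envel n x t else if l ∈ I then 0 else 1)
      (fun l => P.carrier l x t) = wave (P.ζ n) (P.solitonState I n) x t := by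
  obtain ⟨c, hc⟩ := P.scalar.exists_isReduced hn
  obtain ⟨e, he⟩ := P.exists_isReduced hn
  ext a
  obtain ⟨p₀, hp₀, hp₀'⟩ := P.exists_dMul_eq I (fun l => P.u l a)
  set σ := P.sigma n x t with hσ
  have hσ0 : 0 < σ := P.sigma_pos n x t
  set γ := ‖P.comb e‖ ^ 2 / (2 * (P.ζ n).im) with hγ
  set κ := ‖P.chi I n‖ ^ 2 / (2 * (P.ζ n).im) with hκ
  have hη := P.im_pos n
  have hγ0 : 0 ≤ γ := by positivity
  have hκ0 : 0 ≤ κ := by positivity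
  have hκ' : P.scalar.mulD c n = κ := by
    rw [hc.mulD_self, scalar_comb, P.sum_eq_chi hc]; simp [hκ, scalar]
  have hden : (σ ^ 2 + γ * κ : ℂ) ≠ 0 := by
    exact_mod_cast (by positivity : σ ^ 2 + γ * κ ≠ 0)
  have hσc : (σ : ℂ) ≠ 0 := by exact_mod_cast hσ0.ne'
  have hσc' : (1 + σ : ℂ) ≠ 0 := by exact_mod_cast (by positivity : 1 + σ ≠ 0)
  set F := P.carrier n x t with hF
  have hFF : conj F * F = 1 := conj_mul_of_norm_one (P.norm_carrier n x t)
  -- The equations off `n` force `v = vn • c` and `p = p₀ + pn • e*`. The two remaining ones, `σ vn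
  -- + F γ pn = F (P.comb e a)` and `σ pn = F* κ vn`, determine these values.
  set vn : ℂ := F * P.comb e a * (σ / (σ ^ 2 + γ * κ)) with hvn
  set pn : ℂ := conj F * κ * vn / σ with hpn
  have hen : P.envel n x t = σ / (1 + σ) := rfl
  -- Pair `d p₀` with `e`: the result is zero because `e d` vanishes on `I`, the support of `p₀`.
  have hp₀n : P.dMul p₀ n = P.u n a - P.comb e a := by
    have h1 := P.sum_mul_dMul e p₀
    rw [Finset.sum_eq_zero (s := Finset.univ) (f := fun k => P.mulD e k * p₀ k), he.sum_eq] at h1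
    · have h2 : P.comb e a = ∑ l, e l * P.u l a := by simp [comb]
      rw [h2, he.sum_eq, ← sub_eq_zero]
      rw [Finset.sum_congr rfl (fun (l : I) _ => by rw [hp₀' l l.2])] at h1
      linear_combination h1
    · intro k _
      by_cases hk : k ∈ I
      · simp [he.mulD_eq_zero k hk]
      · simp [hp₀ k hk]
  have he' : ∀ l, P.dMul (fun k => conj (e k)) l = conj (P.mulD e l) := fun l => by
    simp [dMul_eq_conj]
  set p : Fin N → ℂ := p₀ + pn • fun k => conj (e k) with hp
  have hpl : ∀ l, P.dMul p l = P.dMul p₀ l + pn * conj (P.mulD e l) := fun l => by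
    rw [hp, dMul_add, dMul_smul, he']
  rw [P.sysSol_eq (v := vn • c) (p := p), P.wave_solitonState he, ← hσ, ← hγ, ← hκ, ← hF]
  · simp only [Pi.smul_apply, smul_eq_mul, ← Finset.mul_sum, P.sum_eq_chi hc, hvn]
    push_cast
    ring
  · exact fun l => P.norm_carrier l x t
  · intro l
    by_cases hl : l = n
    · subst hl
      simp only [if_true]
      rw [hpl, hp₀n, he.mulD_self, Complex.conj_ofReal, hen, Pi.smul_apply, hc.apply_self]
      rw [← hγ, ← hF, hpn, smul_eq_mul]
      push_cast
      have h5 : vn * (σ ^ 2 + γ * κ) = F * P.comb e a * σ := by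
        rw [hvn]; field_simp
      field_simp
      linear_combination h5 + γ * κ * vn * hFF
    · by_cases hlI : l ∈ I
      · simp [hl, hlI, hpl, hp₀' l hlI, he.mulD_eq_zero l hlI]
      · simp [hl, hlI, hc.apply_of_not_mem l hl hlI]
  · intro l
    by_cases hl : l = n
    · subst hl
      simp only [if_true]
      rw [mulD_smul, hκ', hen, hp, Pi.add_apply, hp₀ l hn, Pi.smul_apply, he.apply_self, ← hF, hpn]
      push_cast
      simp only [map_one, smul_eq_mul]
      field_simp
      ring
    · by_cases hlI : l ∈ I
      · simp [hl, hlI, mulD_smul, hc.mulD_eq_zero l hlI]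
      · simp [hl, hlI, hp, he.apply_of_not_mem l hl hlI, hp₀ l hlI]

/-! ### Asymptotic states. -/

/-- The compactified envelope variable as a function of `x + 4 ξ t`. -/
def envelProfile (l : Fin N) (X : ℝ) : ℝ :=
  1 - 1 / (1 + Real.exp (2 * (P.ζ l).im * X + P.α l) / (2 * (P.ζ l).im))

theorem envel_eq_profile (l : Fin N) (x t : ℝ) :
    P.envel l x t = P.envelProfile l (x + 4 * (P.ζ l).re * t) := by
  rw [envelProfile, eq_sub_iff_add_eq, ← eq_sub_iff_add_eq', one_sub_envel]
  rfl

theorem tendsto_exponent_atTop {η : ℝ} (hη : 0 < η) (β : ℝ) :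
    Filter.Tendsto (fun X : ℝ => 2 * η * X + β) Filter.atTop Filter.atTop :=
  Filter.tendsto_atTop_add_const_right _ _
    (Filter.Tendsto.const_mul_atTop (by positivity) Filter.tendsto_id)

theorem tendsto_exponent_atBot {η : ℝ} (hη : 0 < η) (β : ℝ) :
    Filter.Tendsto (fun X : ℝ => 2 * η * X + β) Filter.atBot Filter.atBot :=
  Filter.tendsto_atBot_add_const_right _ _
    (Filter.Tendsto.const_mul_atBot (by positivity) Filter.tendsto_id)

theorem tendsto_envelProfile_atTop (l : Fin N) :
    Filter.Tendsto (P.envelProfile l) Filter.atTop (nhds 1) := by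
  have hη := P.im_pos l
  have h1 : Filter.Tendsto (fun X : ℝ => 1 + Real.exp (2 * (P.ζ l).im * X + P.α l) /
      (2 * (P.ζ l).im)) Filter.atTop Filter.atTop :=
    Filter.tendsto_atTop_add_const_left _ _
      ((Real.tendsto_exp_atTop.comp (tendsto_exponent_atTop hη _)).atTop_div_const (by positivity))
  have h2 := (tendsto_const_nhds (x := (1 : ℝ))).sub h1.inv_tendsto_atTop
  rw [sub_zero] at h2
  refine h2.congr fun X => ?_
  simp [envelProfile]

theorem tendsto_envelProfile_atBot (l : Fin N) :
    Filter.Tendsto (P.envelProfile l) Filter.atBot (nhds 0) := by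
  have hη := P.im_pos l
  have h1 := ((Real.tendsto_exp_atBot.comp (tendsto_exponent_atBot hη (P.α l))).div_const
    (2 * (P.ζ l).im)).const_add 1
  have h2 := (tendsto_const_nhds (x := (1 : ℝ))).sub (h1.inv₀ (by simp))
  simp only [zero_div, add_zero, inv_one, sub_self] at h2
  refine h2.congr fun X => ?_
  simp [envelProfile]

theorem tendsto_inv_cosh_atTop :
    Filter.Tendsto (fun y : ℝ => (Real.cosh y)⁻¹) Filter.atTop (nhds 0) := by
  apply Filter.Tendsto.inv_tendsto_atTop
  refine Filter.tendsto_atTop_mono (f := fun y => Real.exp y / 2) (fun y => ?_)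
    (Real.tendsto_exp_atTop.atTop_div_const (by norm_num))
  rw [Real.cosh_eq]
  have := Real.exp_pos (-y)
  linarith

theorem tendsto_inv_cosh_atBot :
    Filter.Tendsto (fun y : ℝ => (Real.cosh y)⁻¹) Filter.atBot (nhds 0) :=
  (tendsto_inv_cosh_atTop.comp Filter.tendsto_neg_atBot_atTop).congr fun y => by
    simp [Real.cosh_neg]

theorem norm_wave {ζ : ℂ} (hζ : 0 < ζ.im) {s : SolitonState m} (hs : ‖s.pol‖ = 1) (x t : ℝ) :
    ‖wave ζ s x t‖ =
      2 * ζ.im * (Real.cosh (2 * ζ.im * (x + 4 * ζ.re * t) + s.phase))⁻¹ := by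
  have h1 : ‖Complex.exp (-Complex.I * Theta ζ x t)‖ = 1 := by
    rw [neg_mul, mul_comm, ← neg_mul, ← Complex.ofReal_neg, Complex.norm_exp_ofReal_mul_I]
  have h2 := Real.cosh_pos (tau ζ x t + s.phase)
  rw [wave, norm_smul, norm_mul, h1, hs, mul_one, mul_one, Complex.norm_real,
    Real.norm_of_nonneg (by positivity)]
  rfl

/-- Far away from its centre, every soliton is close to its limits. -/
theorem exists_radius (s : Fin N → SolitonState m) {δ ε : ℝ} (hδ : 0 < δ) (hε : 0 < ε) :
    ∃ R : ℝ, ∀ X, R ≤ |X| → ∀ l, (X < 0 → |P.envelProfile l X| < δ) ∧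
      (0 < X → |P.envelProfile l X - 1| < δ) ∧
      2 * (P.ζ l).im * (Real.cosh (2 * (P.ζ l).im * X + (s l).phase))⁻¹ < ε := by
  have hT : ∀ᶠ X in Filter.atTop, ∀ l, |P.envelProfile l X - 1| < δ ∧
      2 * (P.ζ l).im * (Real.cosh (2 * (P.ζ l).im * X + (s l).phase))⁻¹ < ε := by
    refine Filter.eventually_all.mpr fun l => ?_
    have h1 := (Metric.tendsto_nhds.mp (P.tendsto_envelProfile_atTop l)) δ hδ
    have h2 := (tendsto_inv_cosh_atTop.comp
      (tendsto_exponent_atTop (P.im_pos l) (s l).phase)).const_mul (2 * (P.ζ l).im)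
    rw [mul_zero] at h2
    filter_upwards [h1, h2.eventually_lt_const hε] with X hX hX'
    exact ⟨hX, hX'⟩
  have hB : ∀ᶠ X in Filter.atBot, ∀ l, |P.envelProfile l X| < δ ∧
      2 * (P.ζ l).im * (Real.cosh (2 * (P.ζ l).im * X + (s l).phase))⁻¹ < ε := by
    refine Filter.eventually_all.mpr fun l => ?_
    have h1 := (Metric.tendsto_nhds.mp (P.tendsto_envelProfile_atBot l)) δ hδ
    have h2 := (tendsto_inv_cosh_atBot.comp
      (tendsto_exponent_atBot (P.im_pos l) (s l).phase)).const_mul (2 * (P.ζ l).im)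
    rw [mul_zero] at h2
    filter_upwards [h1, h2.eventually_lt_const hε] with X hX hX'
    exact ⟨by simpa using hX, hX'⟩
  obtain ⟨R₁, h₁⟩ := Filter.eventually_atTop.mp hT
  obtain ⟨R₂, h₂⟩ := Filter.eventually_atBot.mp hB
  -- The bound `1` excludes `X = 0`.
  refine ⟨max (max R₁ (-R₂)) 1, fun X hX l => ?_⟩
  have hX1 : R₁ ≤ |X| := le_trans (le_trans (le_max_left _ _) (le_max_left _ _)) hX
  have hX2 : -R₂ ≤ |X| := le_trans (le_trans (le_max_right _ _) (le_max_left _ _)) hX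
  have hX3 : 1 ≤ |X| := le_trans (le_max_right _ _) hX
  rcases lt_trichotomy X 0 with h | h | h
  · rw [abs_of_neg h] at hX2
    have := h₂ X (by linarith) l
    exact ⟨fun _ => this.1, fun h' => absurd h' h.asymm, this.2⟩
  · rw [h, abs_zero] at hX3; linarith
  · rw [abs_of_pos h] at hX1
    have := h₁ X hX1 l
    exact ⟨fun h' => absurd h' h.asymm, fun _ => this.1, this.2⟩

/-- Both time limits at once: the sign hypotheses say that `I n` consists of the solitons to the
right of `n`. -/
theorem isAsymptoticState {f : Filter ℝ} (hf : Filter.Tendsto (fun t : ℝ => |t|) f Filter.atTop)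
    (I : Fin N → Finset (Fin N)) (hI : ∀ n, n ∉ I n)
    (hneg : ∀ᶠ t in f, ∀ n, ∀ k ∈ I n, ((P.ζ k).re - (P.ζ n).re) * t < 0)
    (hpos : ∀ᶠ t in f, ∀ n, ∀ k ∉ I n, k ≠ n → 0 < ((P.ζ k).re - (P.ζ n).re) * t) :
    P.IsAsymptoticState f fun n => P.solitonState (I n) n := by
  have hunit : ∀ n, ‖(P.solitonState (I n) n).pol‖ = 1 := fun n => P.norm_pol (hI n)
  refine ⟨hunit, ?_⟩
  rw [Metric.tendstoUniformly_iff]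
  intro ε hε
  obtain ⟨δ, hδ, huc⟩ := Metric.uniformContinuousOn_iff.mp P.uniformContinuousOn_sysSol
    (ε / 2) (by positivity)
  obtain ⟨R, hR⟩ := P.exists_radius (fun n => P.solitonState (I n) n) hδ
    -- The waves of the fewer than `N + 1` other solitons then contribute at most `ε / 2` in total.
    (show 0 < ε / (2 * (N + 1)) by positivity)
  have hsep : ∀ᶠ t in f, ∀ n k, k ≠ n → R ≤ 2 * |(P.ζ k).re - (P.ζ n).re| * |t| := by
    refine Filter.eventually_all.mpr fun n => Filter.eventually_all.mpr fun k => ?_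
    by_cases h : k = n
    · exact Filter.Eventually.of_forall fun t h' => absurd h h'
    · have h1 : 0 < |(P.ζ k).re - (P.ζ n).re| :=
        abs_pos.mpr (sub_ne_zero.mpr (P.re_strictAnti.injective.ne h))
      filter_upwards [(Filter.Tendsto.const_mul_atTop (by positivity :
        0 < 2 * |(P.ζ k).re - (P.ζ n).re|) hf).eventually_ge_atTop R] with t ht _
      exact ht
  filter_upwards [hneg, hpos, hsep] with t hneg hpos hsep x
  rw [Pi.zero_apply, dist_zero_left]
  rcases isEmpty_or_nonempty (Fin N) with hN | hN
  · simpa [q] using hε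
  -- Choose the soliton nearest to `x`. Every other one is at least half of its mutual distance from
  -- `n` away from `x`, on the side on which it lies relative to `n`.
  obtain ⟨n, hn⟩ := Finite.exists_min fun k : Fin N => |x + 4 * (P.ζ k).re * t|
  have hfar : ∀ k, k ≠ n → R ≤ |x + 4 * (P.ζ k).re * t| := fun k hk => by
    have h1 := hsep n k hk
    have h2 := hn k
    have h3 := abs_sub (x + 4 * (P.ζ k).re * t) (x + 4 * (P.ζ n).re * t)
    have h4 : x + 4 * (P.ζ k).re * t - (x + 4 * (P.ζ n).re * t) =
      4 * ((P.ζ k).re - (P.ζ n).re) * t := by ring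
    rw [h4, abs_mul, abs_mul, abs_of_pos (by norm_num : (0 : ℝ) < 4)] at h3
    linarith
  have hleft : ∀ k ∈ I n, x + 4 * (P.ζ k).re * t < 0 := fun k hk => by
    have h1 := hneg n k hk
    have h2 := hn k
    by_contra h
    rw [not_lt] at h
    rw [abs_of_nonneg h] at h2
    have := le_abs_self (x + 4 * (P.ζ n).re * t)
    linarith
  have hright : ∀ k ∉ I n, k ≠ n → 0 < x + 4 * (P.ζ k).re * t := fun k hk hkn => by
    have h1 := hpos n k hk hkn
    have h2 := hn k
    by_contra h
    rw [not_lt] at h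
    rw [abs_of_nonpos h] at h2
    have := neg_abs_le (x + 4 * (P.ζ n).re * t)
    linarith
  have hmain : ‖P.q x t - wave (P.ζ n) (P.solitonState (I n) n) x t‖ < ε / 2 := by
    rw [q_eq_sysSol, ← P.sysSol_eq_wave (hI n), ← dist_eq_norm]
    refine huc (fun l => P.envel l x t, fun l => P.carrier l x t)
      (mem_sysDomain.mpr ⟨fun l => P.envel_mem l x t, fun l => P.norm_carrier l x t⟩)
      (fun l => if l = n then P.envel n x t else if l ∈ I n then 0 else 1,
        fun l => P.carrier l x t)
      (mem_sysDomain.mpr ⟨fun l => ?_, fun l => P.norm_carrier l x t⟩) ?_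
    · by_cases hl : l = n
      · simpa [hl] using P.envel_mem n x t
      · by_cases hlI : l ∈ I n <;> simp [hl, hlI]
    · rw [Prod.dist_eq, dist_self, max_lt_iff]
      refine ⟨(dist_pi_lt_iff hδ).mpr fun l => ?_, hδ⟩
      by_cases hl : l = n
      · subst hl; simpa using hδ
      · have h1 := hR _ (hfar l hl) l
        by_cases hlI : l ∈ I n
        · simpa [hl, hlI, envel_eq_profile] using h1.1 (hleft l hlI)
        · simpa [hl, hlI, envel_eq_profile, Real.dist_eq] using h1.2.1 (hright l hlI hl)
  have hrest : ‖∑ k ∈ Finset.univ.erase n, wave (P.ζ k) (P.solitonState (I k) k) x t‖ ≤ ε / 2 := by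
    refine (norm_sum_le_of_le (Finset.univ.erase n) (f := fun k =>
      wave (P.ζ k) (P.solitonState (I k) k) x t) (fun k hk => ?_)).trans
      (b := ∑ k ∈ Finset.univ.erase n, ε / (2 * (N + 1))) ?_
    · rw [norm_wave (P.im_pos k) (hunit k)]
      exact (hR _ (hfar k (Finset.ne_of_mem_erase hk)) k).2.2.le
    · rw [Finset.sum_const, nsmul_eq_mul]
      have h1 : ((Finset.univ.erase n).card : ℝ) ≤ N + 1 := by
        have := Finset.card_le_univ (Finset.univ.erase n)
        rw [Fintype.card_fin] at this
        exact_mod_cast this.trans (Nat.le_succ N)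
      calc ((Finset.univ.erase n).card : ℝ) * (ε / (2 * (N + 1)))
          ≤ (N + 1) * (ε / (2 * (N + 1))) := by gcongr
        _ = ε / 2 := by field_simp
  have hsplit : P.q x t - ∑ k, wave (P.ζ k) (P.solitonState (I k) k) x t =
      (P.q x t - wave (P.ζ n) (P.solitonState (I n) n) x t) -
        ∑ k ∈ Finset.univ.erase n, wave (P.ζ k) (P.solitonState (I k) k) x t := by
    rw [← Finset.add_sum_erase Finset.univ _ (Finset.mem_univ n)]
    abel
  rw [hsplit]
  refine (norm_sub_le _ _).trans_lt ?_
  linarith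

theorem isAsymptoticState_atBot : P.IsAsymptoticState Filter.atBot P.initialConfig.state := by
  refine P.isAsymptoticState Filter.tendsto_abs_atBot_atTop (fun n => Finset.Iio n)
    (by simp) ?_ ?_
  · filter_upwards [Filter.eventually_lt_atBot 0] with t ht n k hk
    have := P.re_strictAnti (Finset.mem_Iio.mp hk)
    exact mul_neg_of_pos_of_neg (sub_pos.mpr this) ht
  · filter_upwards [Filter.eventually_lt_atBot 0] with t ht n k hk hkn
    have := P.re_strictAnti (lt_of_le_of_ne (not_lt.mp fun h => hk (Finset.mem_Iio.mpr h)) hkn.symm)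
    exact mul_pos_of_neg_of_neg (sub_neg.mpr this) ht

theorem isAsymptoticState_atTop : P.IsAsymptoticState Filter.atTop P.finalConfig.state := by
  refine P.isAsymptoticState Filter.tendsto_abs_atTop_atTop (fun n => Finset.Ioi n)
    (by simp) ?_ ?_
  · filter_upwards [Filter.eventually_gt_atTop 0] with t ht n k hk
    have := P.re_strictAnti (Finset.mem_Ioi.mp hk)
    exact mul_neg_of_neg_of_pos (sub_neg.mpr this) ht
  · filter_upwards [Filter.eventually_gt_atTop 0] with t ht n k hk hkn
    have := P.re_strictAnti (lt_of_le_of_ne (not_lt.mp fun h => hk (Finset.mem_Ioi.mpr h)) hkn)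
    exact mul_pos (sub_pos.mpr this) ht

end SolitonData

/-! ### Dressing algebra for the differential equation. -/

/-- The algebraic relations behind the dressing of the zero solution: `S = T + G E K` is inverted
by `R`, where `G` and `K` solve displacement equations with right-hand sides `B` and `J`. -/
structure IsDressing {A : Type*} [Ring A] [StarRing A] (b a T E G K B J S R : A) : Prop where
  S_eq : S = T + G * E * K
  S_mul_R : S * R = 1
  R_mul_S : R * S = 1
  comm_T : T * b = b * T
  comm_E : E * a = a * E
  displ_K : a * K = K * b - J
  displ_G : G * a = b * G - B
  star_K : star K = K
  star_G : star G = G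
  star_T_mul_E : star T * E = 1
  star_E_mul_T : star E * T = 1

namespace IsDressing

variable {A : Type*} [Ring A] [StarRing A] {b a T E G K B J S R : A}

/-- A Woodbury identity: `star T` is inverted by `E`, so the adjoint of `S` is a perturbation of
`E⁻¹` whose inverse is expressed through `R`. -/
theorem star_R (h : IsDressing b a T E G K B J S R) : star R = E - E * K * R * G * E := by
  have h1 : star S = star T + K * star E * G := by
    rw [h.S_eq, star_add, star_mul, star_mul, h.star_K, h.star_G, ← mul_assoc]
  have h2 : star S * (E - E * K * R * G * E) = 1 := by
    have e1 : star S * E = 1 + K * star E * G * E := by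
      rw [h1, add_mul, h.star_T_mul_E]
    have e2 : star S * E * K * R = K * star E := by
      have e3 : K * star E * S = K + K * star E * G * E * K := by
        rw [h.S_eq, mul_add, mul_assoc K (star E) T, h.star_E_mul_T]; noncomm_ring
      rw [e1, add_mul, one_mul, ← e3, mul_assoc, h.S_mul_R, mul_one]
    calc star S * (E - E * K * R * G * E) = star S * E - star S * E * K * R * G * E := by
          noncomm_ring
      _ = 1 := by rw [e2, e1]; noncomm_ring
  have h3 : star R * star S = 1 := by rw [← star_mul, h.S_mul_R, star_one]
  calc star R = star R * (star S * (E - E * K * R * G * E)) := by rw [h2, mul_one]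
    _ = E - E * K * R * G * E := by rw [← mul_assoc, h3, one_mul]

theorem S_mul_b (h : IsDressing b a T E G K B J S R) :
    S * b = b * T + G * a * E * K + G * E * J := by
  rw [h.S_eq]
  linear_combination (norm := noncomm_ring) h.comm_T + G * h.comm_E * K - G * E * h.displ_K

theorem R_mul_b (h : IsDressing b a T E G K B J S R) :
    R * b = b * R + R * B * E * K * R - R * G * E * J * R := by
  have h1 : S * b = b * S - B * E * K + G * E * J := by
    rw [h.S_mul_b, h.S_eq]
    linear_combination (norm := noncomm_ring) h.displ_G * E * K
  have h2 : R * (S * b) * R = R * (b * S - B * E * K + G * E * J) * R := by rw [h1]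
  have h3 : R * (S * b) * R = b * R := by rw [← mul_assoc R, h.R_mul_S, one_mul]
  have h4 : R * (b * S - B * E * K + G * E * J) * R =
      R * b * (S * R) - R * B * E * K * R + R * G * E * J * R := by noncomm_ring
  rw [h3, h4, h.S_mul_R, mul_one] at h2
  rw [h2]; noncomm_ring

theorem R_mul_G_mul_a (h : IsDressing b a T E G K B J S R) :
    R * G * a * E * J = b * (R * G * E * J) - R * G * E * J * (R * G * E * J)
      - R * B * star R * J := by
  rw [h.star_R]
  linear_combination (norm := noncomm_ring) R * h.displ_G * E * J + h.R_mul_b * G * E * J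

/-- The logarithmic derivative of `R` in `x`, up to the factor `-2`. -/
theorem R_deriv_x (h : IsDressing b a T E G K B J S R) :
    R * (b * T + G * a * E * K) * R = b * R - R * G * E * J * R := by
  have h1 : R * (S * b) * R = R * (b * T + G * a * E * K + G * E * J) * R := by rw [h.S_mul_b]
  have h3 : R * (S * b) * R = b * R := by rw [← mul_assoc R, h.R_mul_S, one_mul]
  rw [h3] at h1
  rw [h1]; noncomm_ring

/-- The logarithmic derivative of `R` in `t`, up to a factor. -/
theorem R_deriv_t (h : IsDressing b a T E G K B J S R) :
    R * (b * b * T + G * a * a * E * K) * R =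
      b * b * R - R * G * a * E * J * R - R * G * E * J * b * R := by
  have h1 : S * (b * b) = b * b * T + G * a * a * E * K + G * a * E * J + G * E * J * b := by
    rw [← mul_assoc, h.S_mul_b]
    linear_combination (norm := noncomm_ring)
      b * h.comm_T + G * a * h.comm_E * K - G * a * E * h.displ_K
  have h2 : R * (S * (b * b)) * R =
      R * (b * b * T + G * a * a * E * K + G * a * E * J + G * E * J * b) * R := by rw [h1]
  have h3 : R * (S * (b * b)) * R = b * b * R := by rw [← mul_assoc R, h.R_mul_S, one_mul]
  rw [h3] at h2
  rw [h2]; noncomm_ring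

/-- The matrix form of the Manakov equation. -/
theorem equation (h : IsDressing b a T E G K B J S R) {R₁ Q₁ : A}
    (hR₁ : R₁ = -2 * (R * (b * T + G * a * E * K) * R))
    (hQ₁ : Q₁ = R₁ * (G * E * J) + R * (G * (2 * (a * E)) * J)) :
    -4 * (R * (b * b * T + G * a * a * E * K) * R) +
      (-2 * (b * R₁) + 2 * (Q₁ * R + R * G * E * J * R₁)) =
      -8 * (R * B * star R * J * R) := by
  rw [h.R_deriv_x] at hR₁
  -- With `Q = R G E J`, the adjoint identity collapses the derivative of `Q` to one term; this term
  -- produces the cubic nonlinearity.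
  have e2 : Q₁ = -2 * (R * B * star R * J) := by
    rw [hQ₁, hR₁]
    linear_combination (norm := noncomm_ring) 2 * h.R_mul_G_mul_a
  rw [h.R_deriv_t, e2, hR₁]
  linear_combination (norm := noncomm_ring) 4 * h.R_mul_G_mul_a * R

end IsDressing

/-! ### Calculus for matrix-valued functions; the norm is chosen only to make matrices a normed
algebra. -/

section MatrixCalculus

attribute [local instance] Matrix.linftyOpNormedRing Matrix.linftyOpNormedAlgebra

variable {N : ℕ}

theorem hasDerivAt_diagonal {f : ℝ → Fin N → ℂ} {f' : Fin N → ℂ} {x : ℝ}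
    (h : ∀ l, HasDerivAt (fun y => f y l) (f' l) x) :
    HasDerivAt (fun y => Matrix.diagonal (f y)) (Matrix.diagonal f') x :=
  (LinearMap.toContinuousLinearMap
    (Matrix.diagonalLinearMap (Fin N) ℝ ℂ)).hasFDerivAt.comp_hasDerivAt x (hasDerivAt_pi.mpr h)

theorem contDiff_diagonal {E : Type*} [NormedAddCommGroup E] [NormedSpace ℝ E]
    {f : E → Fin N → ℂ} {n : WithTop ℕ∞} (h : ∀ l, ContDiff ℝ n fun y => f y l) :
    ContDiff ℝ n fun y => Matrix.diagonal (f y) :=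
  (LinearMap.toContinuousLinearMap (Matrix.diagonalLinearMap (Fin N) ℝ ℂ)).contDiff.comp
    (contDiff_pi.mpr h)

theorem hasDerivAt_matrix_inv {S : ℝ → Matrix (Fin N) (Fin N) ℂ} {S' : Matrix (Fin N) (Fin N) ℂ}
    {x : ℝ} (h : HasDerivAt S S' x) (hdet : IsUnit (S x)) :
    HasDerivAt (fun y => (S y)⁻¹) (-((S x)⁻¹ * S' * (S x)⁻¹)) x := by
  obtain ⟨v, hv⟩ := hdet
  have h1 := hasFDerivAt_ringInverse (𝕜 := ℝ) v
  rw [hv] at h1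
  have h2 := h1.comp_hasDerivAt x h
  have h3 : (↑v⁻¹ : Matrix (Fin N) (Fin N) ℂ) = (S x)⁻¹ := by
    rw [← hv, Matrix.coe_units_inv]
  rw [← h3]
  simp only [Matrix.nonsing_inv_eq_ringInverse]
  exact h2.congr_deriv (by simp)

theorem contDiff_matrix_inv {E : Type*} [NormedAddCommGroup E] [NormedSpace ℝ E]
    {S : E → Matrix (Fin N) (Fin N) ℂ} {n : WithTop ℕ∞} (h : ContDiff ℝ n S)
    (hdet : ∀ y, IsUnit (S y)) : ContDiff ℝ n fun y => (S y)⁻¹ := by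
  rw [contDiff_iff_contDiffAt]
  intro y
  obtain ⟨v, hv⟩ := hdet y
  have h1 := contDiffAt_ringInverse ℝ v (n := n)
  rw [hv] at h1
  simp only [Matrix.nonsing_inv_eq_ringInverse]
  exact h1.comp y h.contDiffAt

end MatrixCalculus

/-! ### The soliton matrices as a dressing. -/

namespace SolitonData

variable {N m : ℕ} (P : SolitonData N m)

/-- The entries `e^{τ + α + iΘ} / (2 η)`. -/
def coefT (x t : ℝ) (l : Fin N) : ℂ :=
  Complex.exp (2 * Complex.I * conj (P.ζ l) * x + 4 * Complex.I * conj (P.ζ l) ^ 2 * t + P.α l) /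
    (2 * (P.ζ l).im)

/-- The entries `2 η e^{-τ - α + iΘ}`. -/
def coefE (x t : ℝ) (l : Fin N) : ℂ :=
  2 * (P.ζ l).im *
    Complex.exp (2 * Complex.I * P.ζ l * x + 4 * Complex.I * P.ζ l ^ 2 * t - P.α l)

/-- The exponent `2iζ* x + 4iζ*² t` equals `τ + iΘ`, while the one with `ζ` in `coefE` equals `-τ +
iΘ`. In this form differentiation is multiplication by powers of `iζ*` and `iζ`. -/
theorem coefT_eq (x t : ℝ) (l : Fin N) :
    P.coefT x t l = conj (P.carrier l x t) * P.sigma l x t := by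
  rw [coefT, conj_carrier, sigma]
  push_cast
  rw [mul_div_assoc', ← Complex.exp_add]
  congr 2
  have h : conj (P.ζ l) = (P.ζ l).re - (P.ζ l).im * Complex.I := by
    apply Complex.ext <;> simp
  rw [h, tau, Theta]
  push_cast
  linear_combination (-2 * (P.ζ l).im * x - 8 * (P.ζ l).re * (P.ζ l).im * t
    + 4 * (P.ζ l).im ^ 2 * t * Complex.I) * Complex.I_sq

theorem coefE_eq (x t : ℝ) (l : Fin N) :
    P.coefE x t l = (P.sigma l x t : ℂ)⁻¹ * conj (P.carrier l x t) := by
  rw [coefE, conj_carrier, sigma]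
  push_cast
  rw [inv_div, div_eq_mul_inv, ← Complex.exp_neg, mul_assoc (2 * ((P.ζ l).im : ℂ)) (Complex.exp _),
    ← Complex.exp_add]
  congr 2
  have h : P.ζ l = (P.ζ l).re + (P.ζ l).im * Complex.I := (Complex.re_add_im _).symm
  rw [tau, Theta]
  push_cast
  linear_combination (2 * Complex.I * x + 4 * Complex.I * t *
      (P.ζ l + (P.ζ l).re + (P.ζ l).im * Complex.I)) * h +
    (2 * (P.ζ l).im * x + 8 * (P.ζ l).re * (P.ζ l).im * t
    + 4 * (P.ζ l).im ^ 2 * t * Complex.I) * Complex.I_sq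

theorem hasDerivAt_exp_affine (c d e k : ℂ) (x : ℝ) :
    HasDerivAt (fun y : ℝ => k * Complex.exp (c * y + d + e))
      (c * (k * Complex.exp (c * x + d + e))) x := by
  have h := (((((Complex.ofRealCLM.hasDerivAt (x := x)).const_mul c).add_const d).add_const
    e).cexp).const_mul k
  exact h.congr_deriv (by simp; ring)

theorem hasDerivAt_coefT_x (x t : ℝ) (l : Fin N) :
    HasDerivAt (fun y => P.coefT y t l) (2 * Complex.I * conj (P.ζ l) * P.coefT x t l) x := by
  have := hasDerivAt_exp_affine (2 * Complex.I * conj (P.ζ l))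
    (4 * Complex.I * conj (P.ζ l) ^ 2 * t) (P.α l) (1 / (2 * (P.ζ l).im)) x
  simpa only [coefT, div_eq_inv_mul, mul_one] using this

theorem hasDerivAt_coefT_t (x t : ℝ) (l : Fin N) :
    HasDerivAt (fun s => P.coefT x s l) (4 * Complex.I * conj (P.ζ l) ^ 2 * P.coefT x t l) t := by
  have := hasDerivAt_exp_affine (4 * Complex.I * conj (P.ζ l) ^ 2)
    (2 * Complex.I * conj (P.ζ l) * x) (P.α l) (1 / (2 * (P.ζ l).im)) t
  simpa only [coefT, div_eq_inv_mul, mul_one,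
    add_comm (2 * Complex.I * conj (P.ζ l) * (x : ℂ))] using this

theorem hasDerivAt_coefE_x (x t : ℝ) (l : Fin N) :
    HasDerivAt (fun y => P.coefE y t l) (2 * Complex.I * P.ζ l * P.coefE x t l) x :=
  hasDerivAt_exp_affine (2 * Complex.I * P.ζ l)
    (4 * Complex.I * P.ζ l ^ 2 * t) (-P.α l) (2 * (P.ζ l).im) x

theorem hasDerivAt_coefE_t (x t : ℝ) (l : Fin N) :
    HasDerivAt (fun s => P.coefE x s l) (4 * Complex.I * P.ζ l ^ 2 * P.coefE x t l) t := by
  have := hasDerivAt_exp_affine (4 * Complex.I * P.ζ l ^ 2)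
    (2 * Complex.I * P.ζ l * x) (-P.α l) (2 * (P.ζ l).im) t
  simpa only [coefE, sub_eq_add_neg, add_comm (2 * Complex.I * P.ζ l * (x : ℂ))] using this

theorem contDiff_coefT (l : Fin N) {n : WithTop ℕ∞} :
    ContDiff ℝ n fun p : ℝ × ℝ => P.coefT p.1 p.2 l := by
  have h1 : ContDiff ℝ n fun p : ℝ × ℝ => (p.1 : ℂ) := Complex.ofRealCLM.contDiff.comp contDiff_fst
  have h2 : ContDiff ℝ n fun p : ℝ × ℝ => (p.2 : ℂ) := Complex.ofRealCLM.contDiff.comp contDiff_snd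
  unfold coefT
  fun_prop

theorem contDiff_coefE (l : Fin N) {n : WithTop ℕ∞} :
    ContDiff ℝ n fun p : ℝ × ℝ => P.coefE p.1 p.2 l := by
  have h1 : ContDiff ℝ n fun p : ℝ × ℝ => (p.1 : ℂ) := Complex.ofRealCLM.contDiff.comp contDiff_fst
  have h2 : ContDiff ℝ n fun p : ℝ × ℝ => (p.2 : ℂ) := Complex.ofRealCLM.contDiff.comp contDiff_snd
  unfold coefE
  fun_prop

/-- The diagonal matrix with entries `i ζ_l`. -/
def matA : Matrix (Fin N) (Fin N) ℂ := Matrix.diagonal fun l => Complex.I * P.ζ l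

/-- The diagonal matrix with entries `i ζ_l*`. -/
def matA' : Matrix (Fin N) (Fin N) ℂ := Matrix.diagonal fun l => Complex.I * conj (P.ζ l)

/-- The matrix `d`. -/
def matD : Matrix (Fin N) (Fin N) ℂ := Matrix.of P.d

/-- The transposed Cauchy matrix. -/
def matK : Matrix (Fin N) (Fin N) ℂ := Matrix.of fun j k => P.scalar.d k j

/-- The Gram matrix of the bare polarization vectors. -/
def matGram : Matrix (Fin N) (Fin N) ℂ := Matrix.of fun j k => hdot (P.u j) (P.u k)

/-- The matrix with all entries equal to one. -/
def matOnes (N : ℕ) : Matrix (Fin N) (Fin N) ℂ := Matrix.of fun _ _ => 1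

/-- The matrix `U` with the carrier waves removed from its rows. -/
def matS (x t : ℝ) : Matrix (Fin N) (Fin N) ℂ :=
  Matrix.diagonal (P.coefT x t) + P.matD * Matrix.diagonal (P.coefE x t) * P.matK

theorem matS_eq (x t : ℝ) :
    P.matS x t = Matrix.diagonal (fun l => conj (P.carrier l x t)) * P.U x t := by
  ext j k
  have hF := conj_mul_of_norm_one (P.norm_carrier j x t)
  rw [Matrix.diagonal_mul, U_apply, matS, Matrix.add_apply, mul_add]
  congr 1
  · by_cases h : j = k
    · subst h; simp [coefT_eq]
    · simp [h]
  · rw [Matrix.mul_apply, Finset.mul_sum]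
    refine Finset.sum_congr rfl fun l _ => ?_
    rw [Matrix.mul_diagonal, coefE_eq, matD, matK, Matrix.of_apply, Matrix.of_apply]
    linear_combination (-P.d j l * ((P.sigma l x t : ℂ)⁻¹ * conj (P.carrier l x t)) *
      P.scalar.d k l) * hF

theorem matS_mul (x t : ℝ) :
    P.matS x t * ((P.U x t)⁻¹ * Matrix.diagonal (fun l => P.carrier l x t)) = 1 := by
  have hdet := isUnit_iff_ne_zero.mpr (P.det_U_ne_zero x t)
  rw [matS_eq, Matrix.mul_assoc, ← Matrix.mul_assoc (P.U x t), Matrix.mul_nonsing_inv _ hdet,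
    Matrix.one_mul, Matrix.diagonal_mul_diagonal, ← Matrix.diagonal_one]
  congr 1
  funext l
  exact conj_mul_of_norm_one (P.norm_carrier l x t)

theorem isUnit_matS (x t : ℝ) : IsUnit (P.matS x t) :=
  IsUnit.of_mul_eq_one _ (P.matS_mul x t)

theorem matS_inv (x t : ℝ) :
    (P.matS x t)⁻¹ = (P.U x t)⁻¹ * Matrix.diagonal (fun l => P.carrier l x t) :=
  Matrix.inv_eq_right_inv (P.matS_mul x t)

theorem isDressing (x t : ℝ) : IsDressing P.matA' P.matA (Matrix.diagonal (P.coefT x t))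
    (Matrix.diagonal (P.coefE x t)) P.matD P.matK P.matGram (matOnes N) (P.matS x t)
    (P.matS x t)⁻¹ where
  S_eq := rfl
  S_mul_R := Matrix.mul_nonsing_inv _ ((Matrix.isUnit_iff_isUnit_det _).mp (P.isUnit_matS x t))
  R_mul_S := Matrix.nonsing_inv_mul _ ((Matrix.isUnit_iff_isUnit_det _).mp (P.isUnit_matS x t))
  comm_T := by simp only [matA', Matrix.diagonal_mul_diagonal, mul_comm]
  comm_E := by simp only [matA, Matrix.diagonal_mul_diagonal, mul_comm]
  displ_K := by
    ext j k
    have h := P.ζ_sub_conj_ne j k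
    rw [matA, matA', Matrix.diagonal_mul, Matrix.sub_apply, Matrix.mul_diagonal, matK, matOnes,
      Matrix.of_apply, Matrix.of_apply, scalar_d]
    field_simp
    linear_combination (P.ζ j - conj (P.ζ k)) * Complex.I_sq
  displ_G := by
    ext j k
    rw [matA, matA', Matrix.mul_diagonal, Matrix.sub_apply, Matrix.diagonal_mul, matD, matGram,
      Matrix.of_apply, Matrix.of_apply]
    linear_combination Complex.I * P.d_mul j k + hdot (P.u j) (P.u k) * Complex.I_sq
  star_K := by
    ext j k
    rw [Matrix.star_apply, matK, Matrix.of_apply, Matrix.of_apply]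
    exact P.scalar.conj_d j k
  star_G := by
    ext j k
    rw [Matrix.star_apply, matD, Matrix.of_apply, Matrix.of_apply]
    exact P.conj_d k j
  star_T_mul_E := by
    rw [Matrix.star_eq_conjTranspose, Matrix.diagonal_conjTranspose, Matrix.diagonal_mul_diagonal,
      ← Matrix.diagonal_one]
    congr 1
    funext l
    have h1 : (P.sigma l x t : ℂ) ≠ 0 := by exact_mod_cast (P.sigma_pos l x t).ne'
    have h2 := conj_mul_of_norm_one (P.norm_carrier l x t)
    rw [Pi.star_apply, coefT_eq, coefE_eq, star_mul', ← starRingEnd_apply, ← starRingEnd_apply,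
      Complex.conj_conj, Complex.conj_ofReal]
    field_simp
    linear_combination h2
  star_E_mul_T := by
    rw [Matrix.star_eq_conjTranspose, Matrix.diagonal_conjTranspose, Matrix.diagonal_mul_diagonal,
      ← Matrix.diagonal_one]
    congr 1
    funext l
    have h1 : (P.sigma l x t : ℂ) ≠ 0 := by exact_mod_cast (P.sigma_pos l x t).ne'
    have h2 := conj_mul_of_norm_one (P.norm_carrier l x t)
    rw [Pi.star_apply, coefT_eq, coefE_eq, star_mul', ← starRingEnd_apply, ← starRingEnd_apply,
      Complex.conj_conj, map_inv₀, Complex.conj_ofReal]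
    field_simp
    linear_combination h2

/-- The linear map that takes the matrix `R` to `2 ∑_{j,k} R_{jk} u_k`. -/
def readOut : Matrix (Fin N) (Fin N) ℂ →ₗ[ℂ] EuclideanSpace ℂ (Fin m) where
  toFun M := (2 : ℂ) • ∑ j, ∑ k, M j k • P.u k
  map_add' M M' := by simp [add_smul, Finset.sum_add_distrib]
  map_smul' c M := by
    simp only [Matrix.smul_apply, smul_eq_mul, mul_smul, ← Finset.smul_sum, RingHom.id_apply]
    rw [smul_comm]

theorem q_eq_readOut (x t : ℝ) : P.q x t = P.readOut (P.matS x t)⁻¹ := by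
  simp only [q, readOut, LinearMap.coe_mk, AddHom.coe_mk, matS_inv, Matrix.mul_diagonal, carrier]

/-- The all-ones matrix has rank one, so the product splits into the sum of all entries of `M B M†`,
which is the squared norm of `∑ M_{jk} u_k`, times the read-out of `M`. -/
theorem readOut_cubic (M : Matrix (Fin N) (Fin N) ℂ) :
    P.readOut (M * P.matGram * star M * matOnes N * M) =
      ((‖P.readOut M‖ ^ 2 / 4 : ℝ) : ℂ) • P.readOut M := by
  set y := ∑ j, ∑ k, M j k • P.u k with hy
  have hM : P.readOut M = (2 : ℂ) • y := rfl
  have h1 : ((‖P.readOut M‖ ^ 2 / 4 : ℝ) : ℂ) = hdot y y := by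
    rw [hM, norm_smul, hdot_self]
    simp; ring
  have h2 : hdot y y = ∑ j, ∑ i, (M * P.matGram * star M) j i := by
    simp only [hy, hdot_sum_left, hdot_sum_right, hdot_smul_left, hdot_smul_right, Matrix.mul_apply,
      matGram, Matrix.of_apply, Matrix.star_apply, Finset.sum_mul]
    conv_rhs => rw [Finset.sum_comm]
    refine Finset.sum_congr rfl fun i _ => ?_
    conv_rhs => rw [Finset.sum_comm]
    refine Finset.sum_congr rfl fun j _ => ?_
    simp only [Finset.mul_sum]
    refine Finset.sum_congr rfl fun l _ => Finset.sum_congr rfl fun k _ => ?_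
    rw [starRingEnd_apply]; ring
  rw [h1, h2, hM]
  change (2 : ℂ) • ∑ j, ∑ k, (M * P.matGram * star M * matOnes N * M) j k • P.u k = _
  rw [smul_comm]
  congr 1
  rw [Finset.sum_smul]
  refine Finset.sum_congr rfl fun j _ => ?_
  have h3 : ∀ k, (M * P.matGram * star M * matOnes N * M) j k =
      (∑ i, (M * P.matGram * star M) j i) * ∑ l, M l k := fun k => by
    generalize M * P.matGram * star M = Z
    simp [Matrix.mul_apply, matOnes, Finset.mul_sum]
  simp only [h3, mul_smul, ← Finset.smul_sum]
  congr 1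
  rw [hy, Finset.sum_comm]
  simp only [Finset.sum_smul]

/-! ### Derivatives of the solution and the Manakov equation. -/

section Equation

attribute [local instance] Matrix.linftyOpNormedRing Matrix.linftyOpNormedAlgebra

theorem hasDerivAt_diagonal_coefT_x (x t : ℝ) :
    HasDerivAt (fun y => Matrix.diagonal (P.coefT y t))
      (2 * (P.matA' * Matrix.diagonal (P.coefT x t))) x := by
  refine (hasDerivAt_diagonal fun l => P.hasDerivAt_coefT_x x t l).congr_deriv ?_
  rw [matA', Matrix.diagonal_mul_diagonal, two_mul (Matrix.diagonal _),
    Matrix.diagonal_add]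
  congr 1; funext l; ring

theorem hasDerivAt_diagonal_coefE_x (x t : ℝ) :
    HasDerivAt (fun y => Matrix.diagonal (P.coefE y t))
      (2 * (P.matA * Matrix.diagonal (P.coefE x t))) x := by
  refine (hasDerivAt_diagonal fun l => P.hasDerivAt_coefE_x x t l).congr_deriv ?_
  rw [matA, Matrix.diagonal_mul_diagonal, two_mul (Matrix.diagonal _),
    Matrix.diagonal_add]
  congr 1; funext l; ring

theorem hasDerivAt_diagonal_coefT_t (x t : ℝ) :
    HasDerivAt (fun s => Matrix.diagonal (P.coefT x s))
      ((-4 * Complex.I) • (P.matA' * P.matA' * Matrix.diagonal (P.coefT x t))) t := by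
  refine (hasDerivAt_diagonal fun l => P.hasDerivAt_coefT_t x t l).congr_deriv ?_
  rw [matA', Matrix.diagonal_mul_diagonal, Matrix.diagonal_mul_diagonal, ← Matrix.diagonal_smul]
  congr 1; funext l
  simp only [Pi.smul_apply, smul_eq_mul]
  linear_combination (4 * Complex.I * conj (P.ζ l) ^ 2 * P.coefT x t l) * Complex.I_sq

theorem hasDerivAt_diagonal_coefE_t (x t : ℝ) :
    HasDerivAt (fun s => Matrix.diagonal (P.coefE x s))
      ((-4 * Complex.I) • (P.matA * P.matA * Matrix.diagonal (P.coefE x t))) t := by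
  refine (hasDerivAt_diagonal fun l => P.hasDerivAt_coefE_t x t l).congr_deriv ?_
  rw [matA, Matrix.diagonal_mul_diagonal, Matrix.diagonal_mul_diagonal, ← Matrix.diagonal_smul]
  congr 1; funext l
  simp only [Pi.smul_apply, smul_eq_mul]
  linear_combination (4 * Complex.I * P.ζ l ^ 2 * P.coefE x t l) * Complex.I_sq

theorem hasDerivAt_matS_x (x t : ℝ) :
    HasDerivAt (fun y => P.matS y t) (2 * (P.matA' * Matrix.diagonal (P.coefT x t) +
      P.matD * P.matA * Matrix.diagonal (P.coefE x t) * P.matK)) x := by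
  refine ((P.hasDerivAt_diagonal_coefT_x x t).add
    (((P.hasDerivAt_diagonal_coefE_x x t).const_mul P.matD).mul_const P.matK)).congr_deriv ?_
  noncomm_ring

theorem hasDerivAt_matS_t (x t : ℝ) :
    HasDerivAt (fun s => P.matS x s)
      ((-4 * Complex.I) • (P.matA' * P.matA' * Matrix.diagonal (P.coefT x t) +
      P.matD * P.matA * P.matA * Matrix.diagonal (P.coefE x t) * P.matK)) t := by
  refine ((P.hasDerivAt_diagonal_coefT_t x t).add
    (((P.hasDerivAt_diagonal_coefE_t x t).const_mul P.matD).mul_const P.matK)).congr_deriv ?_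
  simp only [smul_add, mul_smul_comm, smul_mul_assoc, mul_assoc]

/-- The derivative of `R = S⁻¹` in `x`. -/
def derivR (x t : ℝ) : Matrix (Fin N) (Fin N) ℂ :=
  -2 * ((P.matS x t)⁻¹ * (P.matA' * Matrix.diagonal (P.coefT x t) +
      P.matD * P.matA * Matrix.diagonal (P.coefE x t) * P.matK) * (P.matS x t)⁻¹)

theorem hasDerivAt_R_x (x t : ℝ) :
    HasDerivAt (fun y => (P.matS y t)⁻¹) (P.derivR x t) x := by
  refine (hasDerivAt_matrix_inv (P.hasDerivAt_matS_x x t) (P.isUnit_matS x t)).congr_deriv ?_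
  rw [derivR]
  noncomm_ring

theorem hasDerivAt_R_t (x t : ℝ) :
    HasDerivAt (fun s => (P.matS x s)⁻¹) ((4 * Complex.I) • ((P.matS x t)⁻¹ *
      (P.matA' * P.matA' * Matrix.diagonal (P.coefT x t) +
      P.matD * P.matA * P.matA * Matrix.diagonal (P.coefE x t) * P.matK) * (P.matS x t)⁻¹)) t := by
  refine (hasDerivAt_matrix_inv (P.hasDerivAt_matS_t x t) (P.isUnit_matS x t)).congr_deriv ?_
  rw [mul_smul_comm, smul_mul_assoc, ← neg_smul]
  congr 1; ring

/-- The derivative of `Q = R d E J` in `x`. -/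
def derivQ (x t : ℝ) : Matrix (Fin N) (Fin N) ℂ :=
  P.derivR x t * (P.matD * Matrix.diagonal (P.coefE x t) * matOnes N) +
    (P.matS x t)⁻¹ * (P.matD * (2 * (P.matA * Matrix.diagonal (P.coefE x t))) * matOnes N)

theorem hasDerivAt_derivR (x t : ℝ) :
    HasDerivAt (fun y => P.derivR y t) (-2 * (P.matA' * P.derivR x t) +
      2 * (P.derivQ x t * (P.matS x t)⁻¹ + (P.matS x t)⁻¹ * P.matD *
        Matrix.diagonal (P.coefE x t) * matOnes N * P.derivR x t)) x := by
  -- Differentiating the reduced form of `R_deriv_x` involves only `R` and `E`.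
  have h1 : (fun y => P.derivR y t) = fun y => -2 * (P.matA' * (P.matS y t)⁻¹ -
      (P.matS y t)⁻¹ * (P.matD * Matrix.diagonal (P.coefE y t) * matOnes N) * (P.matS y t)⁻¹) := by
    funext y
    rw [derivR, (P.isDressing y t).R_deriv_x]
    simp only [mul_assoc]
  rw [h1]
  have hR := P.hasDerivAt_R_x x t
  have hE := ((P.hasDerivAt_diagonal_coefE_x x t).const_mul P.matD).mul_const (matOnes N)
  have h2 := ((hR.const_mul P.matA').sub ((hR.mul hE).mul hR)).const_mul (-2)
  refine h2.congr_deriv ?_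
  rw [derivQ, Pi.mul_apply]
  generalize P.derivR x t = R₁
  generalize (P.matS x t)⁻¹ = R
  generalize P.matD * (2 * (P.matA * Matrix.diagonal (P.coefE x t))) * matOnes N = X
  simp only [mul_assoc R]
  generalize P.matD * Matrix.diagonal (P.coefE x t) * matOnes N = Y
  noncomm_ring

theorem hasDerivAt_readOut {f : ℝ → Matrix (Fin N) (Fin N) ℂ} {f' : Matrix (Fin N) (Fin N) ℂ}
    {x : ℝ} (h : HasDerivAt f f' x) : HasDerivAt (fun y => P.readOut (f y)) (P.readOut f') x :=
  (LinearMap.toContinuousLinearMap (P.readOut.restrictScalars ℝ)).hasFDerivAt.comp_hasDerivAt x h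

theorem contDiff_q {n : WithTop ℕ∞} : ContDiff ℝ n fun p : ℝ × ℝ => P.q p.1 p.2 := by
  simp only [q_eq_readOut]
  refine (LinearMap.toContinuousLinearMap (P.readOut.restrictScalars ℝ)).contDiff.comp
    (contDiff_matrix_inv ?_ fun p => P.isUnit_matS p.1 p.2)
  exact (contDiff_diagonal fun l => P.contDiff_coefT l).add
    ((contDiff_const.mul (contDiff_diagonal fun l => P.contDiff_coefE l)).mul contDiff_const)

theorem isSolution : IsSolution P.q := by
  refine ⟨P.contDiff_q, fun x t => ?_⟩
  have hx : (deriv fun y => P.q y t) = fun y => P.readOut (P.derivR y t) := by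
    funext y
    simp only [q_eq_readOut]
    exact (P.hasDerivAt_readOut (P.hasDerivAt_R_x y t)).deriv
  have ht := (P.hasDerivAt_readOut (P.hasDerivAt_R_t x t)).deriv
  simp only [← q_eq_readOut] at ht
  rw [iteratedDeriv_succ, iteratedDeriv_one, hx, ht,
    (P.hasDerivAt_readOut (P.hasDerivAt_derivR x t)).deriv]
  have h := congrArg P.readOut ((P.isDressing x t).equation (R₁ := P.derivR x t)
    (Q₁ := P.derivQ x t) rfl rfl)
  have h4 : ∀ M : Matrix (Fin N) (Fin N) ℂ, -4 * M = (-4 : ℂ) • M := fun M => by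
    rw [Algebra.smul_def, map_neg, map_ofNat]
  have h8 : ∀ M : Matrix (Fin N) (Fin N) ℂ, -8 * M = (-8 : ℂ) • M := fun M => by
    rw [Algebra.smul_def, map_neg, map_ofNat]
  rw [map_add, h4, h8, map_smul, map_smul, readOut_cubic, ← q_eq_readOut] at h
  rw [map_smul, smul_smul]
  have e1 : Complex.I * (4 * Complex.I) = -4 := by linear_combination 4 * Complex.I_sq
  rw [e1, h, smul_smul, ← Complex.coe_smul, ← add_smul]
  -- The factor `2` in `readOut` accounts for the `1/4`, so `-8` becomes the coefficient `-2` of the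
  -- nonlinearity.
  have e2 : -8 * ((‖P.q x t‖ ^ 2 / 4 : ℝ) : ℂ) + ((2 * ‖P.q x t‖ ^ 2 : ℝ) : ℂ) = 0 := by
    push_cast; ring
  rw [e2, zero_smul]

end Equation

end SolitonData

end Manakov

end

theorem theorem5p1 {N m : ℕ} (P : Manakov.SolitonData N m) :
    -- the `N`-soliton solution is well defined and solves the Manakov model
    (∀ x t, (P.U x t).det ≠ 0) ∧ Manakov.IsSolution P.q ∧
    -- its asymptotic states
    P.IsAsymptoticState Filter.atBot P.initialConfig.state ∧
    P.IsAsymptoticState Filter.atTop P.finalConfig.state ∧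
    -- factorization into pair collisions in arbitrary order
    (∃ L : List (Fin N × Fin N), Manakov.IsCollisionOrder L) ∧
    ∀ L : List (Fin N × Fin N), Manakov.IsCollisionOrder L →
      L.length = N.choose 2 ∧ L.Nodup ∧ (∀ k j, (k, j) ∈ L ↔ j < k) ∧
      ∀ c : Manakov.Config N m, P.Evolves L P.initialConfig c ↔ c = P.finalConfig :=
  ⟨P.det_U_ne_zero, P.isSolution, P.isAsymptoticState_atBot, P.isAsymptoticState_atTop,
    Manakov.exists_isCollisionOrder N, fun _ hL =>
      ⟨hL.length_eq, hL.nodup, hL.mem_iff, P.evolves_iff hL⟩⟩
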